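/- For $t>0$ let \[f(t):=\int_0^t\frac{dx}{x}\int_0^x\frac{dy}{y}\int_0^y\frac{dz}{z}\bigl\{\sin x+\sin(x-y)-\sin(x-z)-\sin(x-y+z)\bigr\},\] the triple integral being absolutely convergent for every $t>0$ (that is, the function $\frac{1}{xyz}\{\sin x+\sin(x-y)-\sin(x-z)-\sin(x-y+z)\}$ is Lebesgue integrable on $\{0<z<y<x<t\}$). Then, as $t\to+\infty$, \[f(t)=-\frac{\cos t}{2}\,\frac{\log^2 t}{t}+\Bigl(\frac{\pi\sin t}{2}-\gamma\cos t-1\Bigr)\frac{\log t}{t}+\Bigl(\frac{5\pi^2\cos t}{24}-\frac{\gamma^2\cos t}{2}+\frac{\gamma\pi\sin t}{2}-1-\gamma\Bigr)\frac1t+O\Bigl(\frac{\log^2 t}{t^2}\Bigr),\] where $\gamma$ is Euler's constant and $\log^2 t=(\log t)^2$. -/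

import Mathlib

/-- The integrand `(sin x + sin (x - y) - sin (x - z) - sin (x - y + z)) / (x y z)`. -/
noncomputable def tripleIntegrand (x y z : ℝ) : ℝ :=
  (1 / x) * ((1 / y) * ((1 / z) *
    (Real.sin x + Real.sin (x - y) - Real.sin (x - z) - Real.sin (x - y + z))))

/-- `f(t) = ∫₀ᵗ dx/x ∫₀ˣ dy/y ∫₀ʸ dz/z {sin x + sin (x - y) - sin (x - z) - sin (x - y + z)}`. -/
noncomputable def tripleSine (t : ℝ) : ℝ :=
  ∫ x in (0 : ℝ)..t, ∫ y in (0 : ℝ)..x, ∫ z in (0 : ℝ)..y, tripleIntegrand x y z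

/-! Everything is expressed through Ein on the imaginary axis. Factoring `e^{ix}` out of the
complexified sines and integrating over z and y gives f'(t) = Im(e^{it} G(t)/t), where G =
`innerDouble` = Ein(ix)²/2 + `oscInt 1` + `oscInt (-1)` (`hasDerivAt_tripleSine`).

Three limits determine G up to O(log x / x): Ein(ix) = log x + γ + iπ/2 + O(1/x), and the two
oscillatory integrals tend to the dilogarithm values π²/12 and -π²/6 (`innerDouble_sub_isBigO`).

Two integrations by parts of e^{it} G/t give the explicit `oscillatingPart`. Since G' contains
e^{-it} Ein(-it)/t, one term loses its oscillation: it adds (log t + γ)/t² to the derivative of the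
remainder, hence -(log t + 1 + γ)/t to f. What is left has derivative O(log² t/t³).

This fixes f only up to a constant, which is zero because f(t) → 0. For that limit the region is
rescaled to x, y/x, z/y and x is integrated first. The kernel is then the imaginary part of a
combination of four values of Ein(i·) in which log t and iπ/2 cancel; only real logarithms survive,
and dominated convergence applies (`tendsto_tripleSine`). -/

open MeasureTheory Filter Topology Asymptotics Set
open scoped Interval

/-! ### Convergence with a rate from bounds on the derivative -/

section DerivativeTails

/-- A function whose derivative is dominated by that of a function tending to zero converges, at the
rate given by the latter. -/
theorem exists_isBigO_sub_of_deriv_isBigO {E : Type*} [NormedAddCommGroup E] [NormedSpace ℝ E]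
    [CompleteSpace E] {φ φ' : ℝ → E} {m m' : ℝ → ℝ}
    (hφ : ∀ᶠ x in atTop, HasDerivAt φ (φ' x) x) (hm : ∀ᶠ x in atTop, HasDerivAt m (-m' x) x)
    (hm0 : Tendsto m atTop (𝓝 0)) (hpos : ∀ᶠ x in atTop, 0 ≤ m' x) (hO : φ' =O[atTop] m') :
    ∃ c, (fun x => φ x - c) =O[atTop] m := by
  obtain ⟨K, hK⟩ := hO.bound
  obtain ⟨X, hX⟩ := eventually_atTop.1 (hφ.and (hm.and (hpos.and hK)))
  -- Mean value inequality: the increment of φ is controlled by that of -K m. It yields both the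
  -- Cauchy property and, as y → ∞, the rate.
  have hdiff : ∀ x y, X ≤ x → x ≤ y → ‖φ y - φ x‖ ≤ K * (m x - m y) := by
    intro x y hx hxy
    refine image_norm_le_of_norm_deriv_right_le_deriv_boundary' (f := fun s => φ s - φ x)
      (f' := φ') (a := x) (b := y) (B := fun s => K * (m x - m s)) (B' := fun s => K * m' s)
      ?_ ?_ ?_ ?_ ?_ ?_ ⟨hxy, le_rfl⟩
    · intro s hs
      exact ((hX s (hx.trans hs.1)).1.sub_const _).continuousAt.continuousWithinAt
    · intro s hs
      exact ((hX s (hx.trans hs.1)).1.sub_const _).hasDerivWithinAt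
    · simp
    · intro s hs
      exact (((hX s (hx.trans hs.1)).2.1.const_sub _).const_mul _).continuousAt.continuousWithinAt
    · intro s hs
      have := (((hX s (hx.trans hs.1)).2.1.const_sub (m x)).const_mul K).hasDerivWithinAt (s := Ici s)
      simpa using this
    · intro s hs
      have h := hX s (hx.trans hs.1)
      simpa [abs_of_nonneg h.2.2.1] using h.2.2.2
  have hKm : Tendsto (fun x => K * m x) atTop (𝓝 0) := by simpa using hm0.const_mul K
  have hcauchy : CauchySeq φ := by
    rw [Metric.cauchySeq_iff']
    intro ε hε
    obtain ⟨N, hN⟩ := eventually_atTop.1 (Metric.tendsto_nhds.1 hKm (ε / 2) (by positivity))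
    refine ⟨max N X, fun n hn => ?_⟩
    have h1 := hN (max N X) (le_max_left _ _)
    have h2 := hN n ((le_max_left _ _).trans hn)
    have h3 := hdiff (max N X) n (le_max_right _ _) hn
    rw [Real.dist_eq, sub_zero, abs_lt] at h1 h2
    rw [dist_eq_norm]
    linarith [h1.2, h2.1]
  obtain ⟨c, hc⟩ := cauchySeq_tendsto_of_complete hcauchy
  refine ⟨c, IsBigO.of_bound |K| ?_⟩
  filter_upwards [eventually_ge_atTop X] with x hx
  have h1 : Tendsto (fun y => ‖φ y - φ x‖) atTop (𝓝 ‖c - φ x‖) := (hc.sub_const _).norm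
  have h2 : Tendsto (fun y => K * (m x - m y)) atTop (𝓝 (K * (m x - 0))) :=
    (hm0.const_sub _).const_mul _
  have h3 := le_of_tendsto_of_tendsto h1 h2
    ((eventually_ge_atTop x).mono fun y hy => hdiff x y hx hy)
  rw [norm_sub_rev, Real.norm_eq_abs, ← abs_mul]
  exact h3.trans (by simpa using le_abs_self (K * m x))

theorem exists_isBigO_inv_of_deriv {E : Type*} [NormedAddCommGroup E] [NormedSpace ℝ E]
    [CompleteSpace E] {φ φ' : ℝ → E} (hφ : ∀ᶠ x in atTop, HasDerivAt φ (φ' x) x)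
    (hO : φ' =O[atTop] fun x : ℝ => 1 / x ^ 2) :
    ∃ c, (fun x => φ x - c) =O[atTop] fun x : ℝ => 1 / x := by
  refine exists_isBigO_sub_of_deriv_isBigO hφ (m' := fun x : ℝ => 1 / x ^ 2) ?_ ?_ ?_ hO
  · filter_upwards [eventually_gt_atTop 0] with x hx
    simpa [neg_div] using hasDerivAt_inv hx.ne'
  · simpa using tendsto_inv_atTop_zero
  · exact Eventually.of_forall fun x => by positivity

theorem tendsto_log_pow_div_atTop (n : ℕ) :
    Tendsto (fun x : ℝ => Real.log x ^ n / x) atTop (𝓝 0) :=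
  (Real.isLittleO_pow_log_id_atTop (n := n)).tendsto_div_nhds_zero

/-- Minus the derivative of log x / x is (log x - 1)/x², which is at least half of log x / x² once
log x ≥ 2. -/
theorem exists_isBigO_log_div_of_deriv {E : Type*} [NormedAddCommGroup E] [NormedSpace ℝ E]
    [CompleteSpace E] {φ φ' : ℝ → E} (hφ : ∀ᶠ x in atTop, HasDerivAt φ (φ' x) x)
    (hO : φ' =O[atTop] fun x : ℝ => Real.log x / x ^ 2) :
    ∃ c, (fun x => φ x - c) =O[atTop] fun x : ℝ => Real.log x / x := by
  have hlog := Real.tendsto_log_atTop.eventually_ge_atTop 2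
  refine exists_isBigO_sub_of_deriv_isBigO hφ (m' := fun x : ℝ => (Real.log x - 1) / x ^ 2)
    ?_ ?_ ?_ (hO.trans ?_)
  · filter_upwards [eventually_gt_atTop 0] with x hx
    refine ((Real.hasDerivAt_log hx.ne').fun_div (hasDerivAt_id' x) hx.ne').congr_deriv ?_
    field_simp
    ring
  · simpa using tendsto_log_pow_div_atTop 1
  · filter_upwards [hlog] with x hx
    exact div_nonneg (by linarith) (by positivity)
  · refine IsBigO.of_bound 2 ?_
    filter_upwards [hlog, eventually_gt_atTop 0] with x hx h0
    rw [Real.norm_of_nonneg (div_nonneg (by linarith) (by positivity)),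
      Real.norm_of_nonneg (div_nonneg (by linarith) (by positivity)), ← mul_div_assoc]
    gcongr
    linarith

theorem exists_isBigO_log_sq_div_of_deriv {E : Type*} [NormedAddCommGroup E] [NormedSpace ℝ E]
    [CompleteSpace E] {φ φ' : ℝ → E} (hφ : ∀ᶠ x in atTop, HasDerivAt φ (φ' x) x)
    (hO : φ' =O[atTop] fun x : ℝ => Real.log x ^ 2 / x ^ 3) :
    ∃ c, (fun x => φ x - c) =O[atTop] fun x : ℝ => Real.log x ^ 2 / x ^ 2 := by
  have hlog := Real.tendsto_log_atTop.eventually_ge_atTop 2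
  refine exists_isBigO_sub_of_deriv_isBigO hφ
    (m' := fun x : ℝ => (2 * Real.log x ^ 2 - 2 * Real.log x) / x ^ 3) ?_ ?_ ?_ (hO.trans ?_)
  · filter_upwards [eventually_gt_atTop 0] with x hx
    refine (((Real.hasDerivAt_log hx.ne').fun_pow 2).fun_div ((hasDerivAt_id' x).fun_pow 2)
      (pow_ne_zero 2 hx.ne')).congr_deriv ?_
    field_simp
    ring
  · have h := (tendsto_log_pow_div_atTop 1).pow 2
    simp only [pow_one, div_pow] at h
    simpa using h
  · filter_upwards [hlog, eventually_gt_atTop 0] with x hx h0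
    exact div_nonneg (by nlinarith) (by positivity)
  · refine IsBigO.of_bound 1 ?_
    filter_upwards [hlog, eventually_gt_atTop 0] with x hx h0
    rw [Real.norm_of_nonneg (div_nonneg (by positivity) (by positivity)),
      Real.norm_of_nonneg (div_nonneg (by nlinarith) (by positivity)), one_mul]
    gcongr
    nlinarith

end DerivativeTails

/-! ### The function Ein and its logarithmic growth on the imaginary axis -/

section EntireExponentialIntegral

/-- The entire exponential integral `Ein w = ∫₀¹ (1 - exp (-w v)) / v dv`. -/
noncomputable def ein (w : ℂ) : ℂ := ∫ v in (0 : ℝ)..1, (1 - Complex.exp (-(w * v))) / v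

theorem norm_one_sub_exp_le (w : ℂ) : ‖1 - Complex.exp w‖ ≤ ‖w‖ * Real.exp ‖w‖ := by
  have := Complex.norm_exp_sub_sum_le_norm_mul_exp w 1
  rw [norm_sub_rev]
  simpa using this

theorem norm_one_sub_exp_I_mul_le (y : ℝ) : ‖1 - Complex.exp (-(Complex.I * y))‖ ≤ |y| := by
  have := Real.norm_exp_I_mul_ofReal_sub_one_le (x := -y)
  rw [norm_sub_rev]
  simpa using this

theorem norm_exp_neg_I_mul (y : ℝ) : ‖Complex.exp (-(Complex.I * y))‖ = 1 := by
  have := Complex.norm_exp_ofReal_mul_I (-y)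
  rwa [Complex.ofReal_neg, neg_mul, mul_comm] at this

theorem intervalIntegrable_of_norm_le {E : Type*} [NormedAddCommGroup E] {f : ℝ → E} {a b : ℝ}
    (hf : AEStronglyMeasurable f) (C : ℝ) (hC : ∀ x ∈ Ι a b, ‖f x‖ ≤ C) :
    IntervalIntegrable f volume a b :=
  (intervalIntegrable_const (c := C)).mono_fun' hf.restrict
    ((ae_restrict_iff' measurableSet_uIoc).2 (Eventually.of_forall hC))

theorem measurable_ein_integrand (w : ℂ) :
    Measurable fun v : ℝ => (1 - Complex.exp (-(w * v))) / (v : ℂ) := by fun_prop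

theorem norm_ein_integrand_le (w : ℂ) {v : ℝ} (hv : v ∈ Ι (0 : ℝ) 1) :
    ‖(1 - Complex.exp (-(w * v))) / (v : ℂ)‖ ≤ ‖w‖ * Real.exp ‖w‖ := by
  rw [uIoc_of_le zero_le_one] at hv
  have h0 : 0 < v := hv.1
  rw [norm_div, Complex.norm_real, Real.norm_of_nonneg h0.le, div_le_iff₀ h0]
  refine (norm_one_sub_exp_le _).trans ?_
  rw [norm_neg, norm_mul, Complex.norm_real, Real.norm_of_nonneg h0.le, mul_right_comm]
  gcongr
  exact mul_le_of_le_one_right (norm_nonneg _) hv.2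

/-- Differentiating under the integral cancels the factor 1/v. The integral form of the derivative
is also valid at w = 0, so continuity follows everywhere. -/
theorem hasDerivAt_ein_integral (w : ℂ) :
    HasDerivAt ein (∫ v in (0 : ℝ)..1, Complex.exp (-(w * v))) w := by
  refine (intervalIntegral.hasDerivAt_integral_of_dominated_loc_of_deriv_le
    (F := fun (w : ℂ) (v : ℝ) => (1 - Complex.exp (-(w * v))) / (v : ℂ))
    (F' := fun (w : ℂ) (v : ℝ) => Complex.exp (-(w * v)))
    (bound := fun _ => Real.exp (‖w‖ + 1)) (Metric.ball_mem_nhds w one_pos) ?_ ?_ ?_ ?_ ?_ ?_).2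
  · exact Eventually.of_forall fun w => (measurable_ein_integrand w).aestronglyMeasurable
  · exact intervalIntegrable_of_norm_le (measurable_ein_integrand w).aestronglyMeasurable _
      fun v hv => norm_ein_integrand_le w hv
  · exact Measurable.aestronglyMeasurable (by fun_prop)
  · refine Eventually.of_forall fun v hv z hz => ?_
    rw [uIoc_of_le zero_le_one] at hv
    refine (Complex.norm_exp_le_exp_norm _).trans (Real.exp_le_exp.2 ?_)
    rw [norm_neg, norm_mul, Complex.norm_real, Real.norm_of_nonneg hv.1.le]
    have h1 : ‖z‖ ≤ ‖w‖ + 1 := by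
      have := norm_le_norm_add_norm_sub w z
      rw [Metric.mem_ball, dist_eq_norm, norm_sub_rev] at hz
      rw [norm_sub_rev] at this
      linarith [norm_sub_norm_le z w, norm_sub_rev z w]
    exact (mul_le_of_le_one_right (norm_nonneg _) hv.2).trans h1
  · exact intervalIntegrable_const
  · refine Eventually.of_forall fun v hv z _ => ?_
    rw [uIoc_of_le zero_le_one] at hv
    have hv0 : (v : ℂ) ≠ 0 := Complex.ofReal_ne_zero.2 hv.1.ne'
    refine ((((hasDerivAt_id' z).mul_const (v : ℂ)).fun_neg.cexp.const_sub 1).div_const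
      (v : ℂ)).congr_deriv ?_
    field_simp

theorem hasDerivAt_ein {w : ℂ} (hw : w ≠ 0) :
    HasDerivAt ein ((1 - Complex.exp (-w)) / w) w := by
  convert hasDerivAt_ein_integral w using 1
  simp_rw [← neg_mul]
  rw [integral_exp_mul_complex (neg_ne_zero.2 hw)]
  simp only [Complex.ofReal_one, mul_one, Complex.ofReal_zero, mul_zero, Complex.exp_zero]
  rw [div_neg, ← neg_div, neg_sub]

@[fun_prop]
theorem continuous_ein : Continuous ein :=
  continuous_iff_continuousAt.2 fun w => (hasDerivAt_ein_integral w).continuousAt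

@[fun_prop]
theorem measurable_ein : Measurable ein := continuous_ein.measurable

theorem integral_one_sub_exp_div (c : ℂ) (x : ℝ) :
    ∫ z in (0 : ℝ)..x, (1 - Complex.exp (-(c * z))) / z = ein (c * x) := by
  rcases eq_or_ne x 0 with rfl | hx
  · simp [ein]
  have h := intervalIntegral.smul_integral_comp_mul_left (a := 0) (b := 1)
    (fun z : ℝ => (1 - Complex.exp (-(c * z))) / (z : ℂ)) x
  rw [mul_zero, mul_one] at h
  rw [← h, ein, ← intervalIntegral.integral_smul]
  refine intervalIntegral.integral_congr fun v _ => ?_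
  have hx' : (x : ℂ) ≠ 0 := Complex.ofReal_ne_zero.2 hx
  simp only [Complex.ofReal_mul, Complex.real_smul]
  rw [← mul_div_assoc, mul_div_mul_left _ _ hx', mul_assoc]

theorem norm_ein_I_mul_le (y : ℝ) : ‖ein (Complex.I * y)‖ ≤ |y| := by
  have h := intervalIntegral.norm_integral_le_of_norm_le_const (a := (0 : ℝ)) (b := 1) (C := |y|)
    (f := fun v : ℝ => (1 - Complex.exp (-(Complex.I * y * v))) / (v : ℂ)) ?_
  · simpa [ein] using h
  · intro v hv
    rw [uIoc_of_le zero_le_one] at hv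
    have h0 : 0 < v := hv.1
    rw [norm_div, Complex.norm_real, Real.norm_of_nonneg h0.le, div_le_iff₀ h0, mul_assoc,
      ← Complex.ofReal_mul]
    refine (norm_one_sub_exp_I_mul_le _).trans ?_
    rw [abs_mul, abs_of_pos h0]

theorem hasDerivAt_ein_I_mul {y : ℝ} (hy : y ≠ 0) :
    HasDerivAt (fun y : ℝ => ein (Complex.I * y)) ((1 - Complex.exp (-(Complex.I * y))) / y) y := by
  have hy' : (y : ℂ) ≠ 0 := Complex.ofReal_ne_zero.2 hy
  have h1 : HasDerivAt (fun y : ℝ => Complex.I * (y : ℂ)) (Complex.I * 1) y :=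
    (Complex.ofRealCLM.hasDerivAt (x := y)).const_mul Complex.I
  have h := (hasDerivAt_ein (mul_ne_zero Complex.I_ne_zero hy')).comp y h1
  refine h.congr_deriv ?_
  rw [mul_one, div_mul_eq_mul_div, mul_comm Complex.I (y : ℂ), mul_div_mul_right _ _ Complex.I_ne_zero]

theorem conj_ein (w : ℂ) : (starRingEnd ℂ) (ein w) = ein ((starRingEnd ℂ) w) := by
  rw [ein, ein, intervalIntegral.integral_of_le zero_le_one,
    intervalIntegral.integral_of_le zero_le_one, ← integral_conj]
  simp [← Complex.exp_conj]

/-- The derivative of Ein(ix) has norm at most 2/x. The bound depends only on b/a, which supplies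
dominating functions uniform in the scale. -/
theorem norm_ein_I_mul_sub_le {a b : ℝ} (ha : 0 < a) (hab : a ≤ b) :
    ‖ein (Complex.I * b) - ein (Complex.I * a)‖ ≤ 2 * Real.log (b / a) := by
  have hpos : ∀ x ∈ uIcc a b, 0 < x := fun x hx => by
    rw [uIcc_of_le hab] at hx; exact ha.trans_le hx.1
  have hcont : ContinuousOn (fun x : ℝ => (1 - Complex.exp (-(Complex.I * x))) / (x : ℂ))
      (uIcc a b) :=
    ContinuousOn.div (by fun_prop) (by fun_prop)
      fun x hx => Complex.ofReal_ne_zero.2 (hpos x hx).ne'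
  rw [← intervalIntegral.integral_eq_sub_of_hasDerivAt
    (fun x hx => hasDerivAt_ein_I_mul (hpos x hx).ne') hcont.intervalIntegrable,
    ← integral_inv_of_pos ha (ha.trans_le hab), ← intervalIntegral.integral_const_mul]
  refine intervalIntegral.norm_integral_le_of_norm_le hab (Eventually.of_forall fun x hx => ?_) ?_
  · have h0 : 0 < x := ha.trans hx.1
    rw [norm_div, Complex.norm_real, Real.norm_of_nonneg h0.le, div_eq_mul_inv]
    gcongr
    refine (norm_sub_le _ _).trans ?_
    rw [norm_exp_neg_I_mul, norm_one]
    norm_num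
  · refine (ContinuousOn.mul (by fun_prop) (ContinuousOn.inv₀ (by fun_prop) ?_)).intervalIntegrable
    exact fun x hx => (hpos x hx).ne'

theorem norm_ein_I_mul_sub_le_abs_log {a b : ℝ} (ha : 0 < a) (hb : 0 < b) :
    ‖ein (Complex.I * b) - ein (Complex.I * a)‖ ≤ 2 * |Real.log (b / a)| := by
  rcases le_total a b with h | h
  · exact (norm_ein_I_mul_sub_le ha h).trans (by gcongr; exact le_abs_self _)
  · rw [norm_sub_rev, ← inv_div, Real.log_inv, abs_neg]
    exact (norm_ein_I_mul_sub_le hb h).trans (by gcongr; exact le_abs_self _)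

/-- The derivative of Ein(ix) - log x is -e^{-ix}/x, not absolutely integrable. Adding the
correction i e^{-ix}/x improves it to O(1/x²), and the correction itself is O(1/x). -/
theorem exists_ein_I_mul_sub_log_isBigO :
    ∃ κ : ℂ, (fun x : ℝ => ein (Complex.I * x) - Real.log x - κ) =O[atTop] fun x : ℝ => 1 / x := by
  have key : ∃ κ : ℂ, (fun x : ℝ => ein (Complex.I * x) - Real.log x
      + Complex.I * Complex.exp (-(Complex.I * x)) / x - κ) =O[atTop] fun x : ℝ => 1 / x := by
    refine exists_isBigO_inv_of_deriv
      (φ' := fun x : ℝ => -Complex.I * Complex.exp (-(Complex.I * x)) / x ^ 2) ?_ ?_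
    · filter_upwards [eventually_gt_atTop 0] with x hx
      have hx' : (x : ℂ) ≠ 0 := Complex.ofReal_ne_zero.2 hx.ne'
      have h1 : HasDerivAt (fun y : ℝ => (y : ℂ)) 1 x := Complex.ofRealCLM.hasDerivAt (x := x)
      refine (((hasDerivAt_ein_I_mul hx.ne').fun_sub
        (Real.hasDerivAt_log hx.ne').ofReal_comp).fun_add
        ((((h1.const_mul Complex.I).fun_neg.cexp).const_mul Complex.I).fun_div h1
          hx')).congr_deriv ?_
      simp only [Complex.ofReal_inv]
      field_simp
      linear_combination -(Complex.exp (-(Complex.I * x)) * x) * Complex.I_sq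
    · exact IsBigO.of_bound 1 (Eventually.of_forall fun x => by simp [norm_exp_neg_I_mul])
  obtain ⟨κ, hκ⟩ := key
  refine ⟨κ, ?_⟩
  have h : (fun x : ℝ => Complex.I * Complex.exp (-(Complex.I * x)) / (x : ℂ)) =O[atTop]
      fun x : ℝ => 1 / x := IsBigO.of_bound 1 (Eventually.of_forall fun x => by
    simp [norm_exp_neg_I_mul])
  refine (hκ.sub h).congr_left fun x => ?_
  ring

end EntireExponentialIntegral

/-! ### Identification of the constant γ + iπ/2 -/

section Constant

/-- Ein is integrated along the quarter circle w = x e^{iθ}, where dw/w = i dθ. -/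
theorem ein_I_mul_sub_ein {x : ℝ} (hx : 0 < x) :
    ein (Complex.I * x) - ein x = Complex.I * (Real.pi / 2)
      - Complex.I * ∫ θ in (0 : ℝ)..(Real.pi / 2), Complex.exp (-(x * Complex.exp (Complex.I * θ))) := by
  have hx' : (x : ℂ) ≠ 0 := Complex.ofReal_ne_zero.2 hx.ne'
  have hd : ∀ θ ∈ uIcc (0 : ℝ) (Real.pi / 2),
      HasDerivAt (fun θ : ℝ => ein (x * Complex.exp (Complex.I * θ)))
        (Complex.I * (1 - Complex.exp (-(x * Complex.exp (Complex.I * θ))))) θ := by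
    intro θ _
    have h1 : HasDerivAt (fun y : ℝ => (y : ℂ)) 1 θ := Complex.ofRealCLM.hasDerivAt (x := θ)
    have hw : (x : ℂ) * Complex.exp (Complex.I * θ) ≠ 0 := mul_ne_zero hx' (Complex.exp_ne_zero _)
    refine ((hasDerivAt_ein hw).comp θ ((h1.const_mul Complex.I).cexp.const_mul (x : ℂ))).congr_deriv ?_
    field_simp
  have h := intervalIntegral.integral_eq_sub_of_hasDerivAt hd
    (Continuous.intervalIntegrable (by fun_prop) _ _)
  have hI : Complex.exp (Complex.I * ((Real.pi / 2 : ℝ) : ℂ)) = Complex.I := by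
    rw [mul_comm]; push_cast; exact Complex.exp_pi_div_two_mul_I
  rw [hI, Complex.ofReal_zero, mul_zero, Complex.exp_zero, mul_one, mul_comm (x : ℂ)] at h
  rw [← h, intervalIntegral.integral_const_mul, intervalIntegral.integral_sub
    (Continuous.intervalIntegrable (by fun_prop) _ _)
    (Continuous.intervalIntegrable (by fun_prop) _ _)]
  simp
  ring

/-- The integrand has norm e^{-x cos θ}, which is at most 1 and tends to 0 except at the endpoint
π/2. -/
theorem tendsto_integral_exp_arc :
    Tendsto (fun x : ℝ => ∫ θ in (0 : ℝ)..(Real.pi / 2),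
      Complex.exp (-(x * Complex.exp (Complex.I * θ)))) atTop (𝓝 0) := by
  have hnorm : ∀ x θ : ℝ, ‖Complex.exp (-(x * Complex.exp (Complex.I * θ)))‖
      = Real.exp (-(x * Real.cos θ)) := by
    intro x θ
    rw [Complex.norm_exp, mul_comm Complex.I, Complex.exp_mul_I]
    simp [← Complex.ofReal_cos, ← Complex.ofReal_sin]
  have hpi : (0 : ℝ) ≤ Real.pi / 2 := by positivity
  have h := intervalIntegral.tendsto_integral_filter_of_dominated_convergence
    (a := 0) (b := Real.pi / 2) (μ := volume) (l := atTop) (f := fun _ => (0 : ℂ))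
    (F := fun (x : ℝ) (θ : ℝ) => Complex.exp (-(x * Complex.exp (Complex.I * θ)))) (fun _ => 1)
    (Eventually.of_forall fun x => (Continuous.aestronglyMeasurable (by fun_prop))) ?_
    intervalIntegrable_const ?_
  · simpa using h
  · filter_upwards [eventually_ge_atTop 0] with x hx
    refine Eventually.of_forall fun θ hθ => ?_
    rw [uIoc_of_le hpi] at hθ
    rw [hnorm, Real.exp_le_one_iff]
    have := Real.cos_nonneg_of_neg_pi_div_two_le_of_le (by linarith [hθ.1]) hθ.2
    nlinarith
  · have hne : ∀ᵐ θ : ℝ, θ ≠ Real.pi / 2 := by simp [ae_iff, measure_singleton]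
    filter_upwards [hne] with θ hne hθ
    rw [uIoc_of_le hpi] at hθ
    have hc : 0 < Real.cos θ :=
      Real.cos_pos_of_mem_Ioo ⟨by linarith [hθ.1], lt_of_le_of_ne hθ.2 hne⟩
    rw [tendsto_zero_iff_norm_tendsto_zero]
    simp_rw [hnorm]
    exact Real.tendsto_exp_neg_atTop_nhds_zero.comp (tendsto_id.atTop_mul_const hc)

theorem integral_one_sub_pow_div (n : ℕ) :
    ∫ v in (0 : ℝ)..1, (1 - (1 - v) ^ n) / v = harmonic n := by
  have h : ∀ v ∈ Ι (0 : ℝ) 1, (1 - (1 - v) ^ n) / v = ∑ k ∈ Finset.range n, (1 - v) ^ k := by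
    intro v hv
    rw [uIoc_of_le zero_le_one] at hv
    rw [div_eq_iff hv.1.ne']
    have := geom_sum_mul (1 - v) n
    linarith
  rw [intervalIntegral.integral_congr_ae (Eventually.of_forall h), intervalIntegral.integral_finsetSum]
  · rw [harmonic]
    push_cast
    refine Finset.sum_congr rfl fun k _ => ?_
    rw [intervalIntegral.integral_comp_sub_left (fun v => v ^ k) 1, integral_pow]
    simp
  · exact fun k _ => Continuous.intervalIntegrable (by fun_prop) _ _

/-- The upper bound combines (1 + v) e^{-v} ≤ 1 with Bernoulli: (1 - v)^n ≥ (1 - v²)^n e^{-nv} ≥ (1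
- n v²) e^{-nv}. -/
theorem exp_sub_one_sub_pow_le (n : ℕ) {v : ℝ} (h0 : 0 ≤ v) (h1 : v ≤ 1) :
    0 ≤ Real.exp (-(n * v)) - (1 - v) ^ n ∧
      Real.exp (-(n * v)) - (1 - v) ^ n ≤ n * v ^ 2 * Real.exp (-(n * v)) := by
  have hexp : Real.exp (-(n * v)) = Real.exp (-v) ^ n := by rw [← Real.exp_nat_mul]; ring_nf
  have hb : (1 - v) ≤ Real.exp (-v) := by linarith [Real.add_one_le_exp (-v)]
  refine ⟨by rw [hexp, sub_nonneg]; exact pow_le_pow_left₀ (by linarith) hb n, ?_⟩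
  have h2 : (1 + v) ^ n * Real.exp (-v) ^ n ≤ 1 := by
    rw [← mul_pow]
    refine pow_le_one₀ (by positivity) ?_
    rw [Real.exp_neg, ← div_eq_mul_inv, div_le_one (Real.exp_pos _)]
    linarith [Real.add_one_le_exp v]
  have h3 : 1 - n * v ^ 2 ≤ (1 - v) ^ n * (1 + v) ^ n := by
    have := one_add_mul_le_pow (a := -v ^ 2) (by nlinarith) n
    rw [← mul_pow]
    calc 1 - n * v ^ 2 = 1 + n * (-v ^ 2) := by ring
      _ ≤ _ := this
      _ = _ := by ring
  have h4 : (1 - v) ^ n * ((1 + v) ^ n * Real.exp (-v) ^ n) ≤ (1 - v) ^ n :=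
    mul_le_of_le_one_right (pow_nonneg (by linarith) n) h2
  have h5 := mul_le_mul_of_nonneg_right h3 (pow_nonneg (Real.exp_pos (-v)).le n)
  rw [hexp]
  linarith

/-- The harmonic number is the integral for Ein(n) with e^{-nv} replaced by (1 - v)^n. The two
integrands differ by at most nv e^{-nv}, which is bounded by 1 and tends to 0. -/
theorem tendsto_ein_sub_harmonic :
    Tendsto (fun n : ℕ => ein (n : ℝ) - (harmonic n : ℝ)) atTop (𝓝 0) := by
  have heq : ∀ n : ℕ, ein (n : ℝ) - (harmonic n : ℝ)
      = ((∫ v in (0 : ℝ)..1, ((1 - v) ^ n - Real.exp (-(n * v))) / v : ℝ) : ℂ) := by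
    intro n
    have h1 : ein (n : ℝ) = ((∫ v in (0 : ℝ)..1, (1 - Real.exp (-(n * v))) / v : ℝ) : ℂ) := by
      rw [ein, ← intervalIntegral.integral_ofReal]
      push_cast
      rfl
    have h2 : IntervalIntegrable (fun v : ℝ => (1 - Real.exp (-(n * v))) / v) volume 0 1 := by
      refine intervalIntegrable_of_norm_le (Measurable.aestronglyMeasurable (by fun_prop))
        (‖((n : ℝ) : ℂ)‖ * Real.exp ‖((n : ℝ) : ℂ)‖) fun v hv => ?_
      have := norm_ein_integrand_le (n : ℝ) hv
      rwa [← Complex.norm_real, Complex.ofReal_div, Complex.ofReal_sub, Complex.ofReal_exp,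
        Complex.ofReal_neg, Complex.ofReal_mul, Complex.ofReal_one]
    have h3 : IntervalIntegrable (fun v : ℝ => (1 - (1 - v) ^ n) / v) volume 0 1 := by
      have : IntervalIntegrable (fun v : ℝ => ∑ k ∈ Finset.range n, (1 - v) ^ k) volume 0 1 :=
        Continuous.intervalIntegrable (by fun_prop) _ _
      refine this.congr fun v hv => ?_
      rw [uIoc_of_le zero_le_one] at hv
      rw [eq_div_iff hv.1.ne']
      have := geom_sum_mul (1 - v) n
      linarith
    rw [h1, ← integral_one_sub_pow_div, ← Complex.ofReal_sub, ← intervalIntegral.integral_sub h2 h3]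
    congr 2
    ext v
    ring
  simp_rw [heq]
  rw [← Complex.ofReal_zero]
  refine (Complex.continuous_ofReal.tendsto 0).comp ?_
  have hle : ∀ (n : ℕ), ∀ v ∈ Ι (0 : ℝ) 1, ‖((1 - v) ^ n - Real.exp (-(n * v))) / v‖
      ≤ (n * v) * Real.exp (-(n * v)) := by
    intro n v hv
    rw [uIoc_of_le zero_le_one] at hv
    have h := exp_sub_one_sub_pow_le n hv.1.le hv.2
    rw [norm_div, Real.norm_of_nonneg hv.1.le, div_le_iff₀ hv.1, norm_sub_rev,
      Real.norm_of_nonneg h.1]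
    refine h.2.trans (le_of_eq ?_)
    ring
  have h := intervalIntegral.tendsto_integral_filter_of_dominated_convergence
    (a := 0) (b := 1) (μ := volume) (l := atTop) (f := fun _ => (0 : ℝ))
    (F := fun (n : ℕ) (v : ℝ) => ((1 - v) ^ n - Real.exp (-(n * v))) / v) (fun _ => 1)
    (Eventually.of_forall fun n => Measurable.aestronglyMeasurable (by fun_prop)) ?_
    intervalIntegrable_const ?_
  · simpa using h
  · refine Eventually.of_forall fun n => Eventually.of_forall fun v hv => (hle n v hv).trans ?_
    rw [Real.exp_neg, ← div_eq_mul_inv, div_le_one (Real.exp_pos _)]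
    linarith [Real.add_one_le_exp (n * v)]
  · refine Eventually.of_forall fun v hv => squeeze_zero_norm (fun n => hle n v hv) ?_
    rw [uIoc_of_le zero_le_one] at hv
    have := Real.tendsto_pow_mul_exp_neg_atTop_nhds_zero 1
    simp only [pow_one] at this
    exact this.comp (tendsto_natCast_atTop_atTop.atTop_mul_const hv.1)

/-- `Ein (i x) = log x + γ + i π / 2 + O(1 / x)`. -/
theorem ein_I_mul_sub_log_isBigO :
    (fun x : ℝ => ein (Complex.I * x) - Real.log x
      - (Real.eulerMascheroniConstant + Complex.I * (Real.pi / 2))) =O[atTop]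
        fun x : ℝ => 1 / x := by
  obtain ⟨κ, hκ⟩ := exists_ein_I_mul_sub_log_isBigO
  have hinv : Tendsto (fun x : ℝ => 1 / x) atTop (𝓝 0) := by simpa using tendsto_inv_atTop_zero
  have h1 : Tendsto (fun x : ℝ => ein (Complex.I * x) - Real.log x) atTop (𝓝 κ) := by
    simpa using (hκ.trans_tendsto hinv).add_const κ
  have h2 : Tendsto (fun x : ℝ => ein (Complex.I * x) - ein x) atTop
      (𝓝 (Complex.I * (Real.pi / 2) - Complex.I * 0)) := by
    refine ((tendsto_integral_exp_arc.const_mul _).const_sub _).congr' ?_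
    filter_upwards [eventually_gt_atTop 0] with x hx
    rw [ein_I_mul_sub_ein hx]
  have h3 : Tendsto (fun n : ℕ => ((harmonic n - Real.log n : ℝ) : ℂ)) atTop
      (𝓝 (Real.eulerMascheroniConstant : ℂ)) :=
    (Complex.continuous_ofReal.tendsto _).comp Real.tendsto_harmonic_sub_log
  -- Along integers, Ein(in) - log n = (Ein(in) - Ein(n)) + (Ein(n) - H_n) + (H_n - log n), with
  -- limits iπ/2, 0 and γ.
  have h4 := ((h2.comp tendsto_natCast_atTop_atTop).add tendsto_ein_sub_harmonic).add h3
  have h5 : κ = Real.eulerMascheroniConstant + Complex.I * (Real.pi / 2) := by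
    refine tendsto_nhds_unique (h1.comp tendsto_natCast_atTop_atTop) ?_
    convert h4 using 2
    · simp
    · ring
  rwa [h5] at hκ

end Constant

/-! ### Dilogarithm values at ±1 -/

section LogIntegrals

theorem log_one_add_le_two_mul_sqrt {s : ℝ} (hs : 0 ≤ s) : Real.log (1 + s) ≤ 2 * √s := by
  have h1 : Real.log (1 + s) = 2 * Real.log √(1 + s) := by
    rw [Real.log_sqrt (by linarith)]; ring
  have h2 : Real.log √(1 + s) ≤ √(1 + s) - 1 := Real.log_le_sub_one_of_pos (by positivity)
  have h3 : √(1 + s) ≤ 1 + √s := by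
    rw [Real.sqrt_le_left (by positivity)]
    nlinarith [Real.sq_sqrt hs, Real.sqrt_nonneg s]
  linarith

theorem neg_log_one_sub_le {v : ℝ} (h0 : 0 < v) (h1 : v < 1) :
    -Real.log (1 - v) ≤ 2 * (√v / √(1 - v)) := by
  have h : (0 : ℝ) < 1 - v := by linarith
  rw [← Real.log_inv, ← Real.sqrt_div h0.le]
  convert log_one_add_le_two_mul_sqrt (div_nonneg h0.le h.le) using 2
  field_simp
  ring

theorem abs_log_one_add_mul_le {s v : ℝ} (hs : |s| ≤ 1) (h0 : 0 < v) (h1 : v < 1) :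
    |Real.log (1 + s * v)| ≤ -Real.log (1 - v) := by
  have h : (0 : ℝ) < 1 - v := by linarith
  obtain ⟨hs1, hs2⟩ := abs_le.1 hs
  have h2 : 1 - v ≤ 1 + s * v := by nlinarith
  have h3 : 1 + s * v ≤ (1 - v)⁻¹ := by
    have h4 : 1 + s * v ≤ 1 + v := by nlinarith
    rw [le_inv_comm₀ (by linarith) h, ← one_div, le_div_iff₀ (by linarith)]
    nlinarith [mul_le_mul_of_nonneg_left h4 h.le]
  rw [abs_le, neg_neg]
  refine ⟨Real.log_le_log h h2, ?_⟩
  rw [← Real.log_inv]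
  exact Real.log_le_log (by linarith) h3

/-- This is the integrand of B(1/2, 1/2). It serves as the majorant for all logarithmic
singularities at 0 and 1. -/
theorem intervalIntegrable_inv_sqrt_mul_sqrt :
    IntervalIntegrable (fun v : ℝ => 1 / (√v * √(1 - v))) volume 0 1 := by
  have h := (Complex.betaIntegral_convergent (u := 1 / 2) (v := 1 / 2) (by norm_num)
    (by norm_num)).norm
  rw [intervalIntegrable_iff_integrableOn_Ioo_of_le zero_le_one] at h ⊢
  refine h.congr_fun (fun v hv => ?_) measurableSet_Ioo
  have h1 : (0 : ℝ) < 1 - v := by linarith [hv.2]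
  have h2 : (1 : ℂ) - v = ((1 - v : ℝ) : ℂ) := by push_cast; rfl
  simp only [norm_mul, h2]
  rw [Complex.norm_cpow_eq_rpow_re_of_pos hv.1, Complex.norm_cpow_eq_rpow_re_of_pos h1]
  have h3 : ((1 : ℂ) / 2 - 1).re = -(1 / 2) := by norm_num
  rw [h3, Real.rpow_neg hv.1.le, Real.rpow_neg h1.le, ← Real.sqrt_eq_rpow, ← Real.sqrt_eq_rpow,
    one_div, mul_inv]

theorem ae_ne_one : ∀ᵐ v : ℝ, v ≠ 1 := by simp [ae_iff, measure_singleton]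

theorem neg_log_one_sub_div_le {v : ℝ} (h0 : 0 < v) (h1 : v < 1) :
    -Real.log (1 - v) / v ≤ 2 * (1 / (√v * √(1 - v))) := by
  have h := neg_log_one_sub_le h0 h1
  have h2 : 0 < √(1 - v) := Real.sqrt_pos.2 (by linarith)
  have h3 : 0 < √v := Real.sqrt_pos.2 h0
  rw [div_le_iff₀ h0]
  refine h.trans (le_of_eq ?_)
  field_simp
  exact Real.sq_sqrt h0.le

theorem intervalIntegrable_neg_log_one_sub_div :
    IntervalIntegrable (fun v : ℝ => -Real.log (1 - v) / v) volume 0 1 := by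
  refine (intervalIntegrable_inv_sqrt_mul_sqrt.const_mul 2).mono_fun'
    (Measurable.aestronglyMeasurable (by fun_prop)) ?_
  rw [EventuallyLE, ae_restrict_iff' measurableSet_uIoc]
  filter_upwards [ae_ne_one] with v hne hv
  rw [uIoc_of_le zero_le_one] at hv
  have h1 : v < 1 := lt_of_le_of_ne hv.2 hne
  rw [Real.norm_of_nonneg (div_nonneg _ hv.1.le)]
  · exact neg_log_one_sub_div_le hv.1 h1
  · exact neg_nonneg.2 (Real.log_nonpos (by linarith) (by linarith [hv.1]))

/-- The series is integrated term by term. For |s| ≤ 1 it is majorised by the positive series of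
-log(1 - v)/v, whose sum is integrable, so the boundary values s = ±1 need no Abel summation. -/
theorem hasSum_integral_log_one_add_mul_div {s : ℝ} (hs : |s| ≤ 1) :
    HasSum (fun n : ℕ => -((-s) ^ (n + 1) / ((n : ℝ) + 1) ^ 2))
      (∫ v in (0 : ℝ)..1, Real.log (1 + s * v) / v) := by
  have hlog : ∀ v ∈ Ι (0 : ℝ) 1, v ≠ 1 →
      HasSum (fun n : ℕ => v ^ n / ((n : ℝ) + 1)) (-Real.log (1 - v) / v) := by
    intro v hv hne
    rw [uIoc_of_le zero_le_one] at hv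
    have h1 : v < 1 := lt_of_le_of_ne hv.2 hne
    refine ((Real.hasSum_pow_div_log_of_abs_lt_one
      (by rwa [abs_of_pos hv.1])).div_const v).congr_fun fun n => ?_
    have := hv.1.ne'
    field_simp
    ring
  have h := intervalIntegral.hasSum_integral_of_dominated_convergence (a := 0) (b := 1)
    (μ := volume) (F := fun (n : ℕ) (v : ℝ) => -((-s) ^ (n + 1) / ((n : ℝ) + 1)) * v ^ n)
    (f := fun v => Real.log (1 + s * v) / v) (fun (n : ℕ) v => v ^ n / ((n : ℝ) + 1))
    (fun n => Measurable.aestronglyMeasurable (by fun_prop)) ?_ ?_ ?_ ?_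
  · refine h.congr_fun fun n => ?_
    rw [intervalIntegral.integral_const_mul, integral_pow]
    simp
    field_simp
  · refine fun n => Eventually.of_forall fun v hv => ?_
    rw [uIoc_of_le zero_le_one] at hv
    rw [norm_mul, norm_neg, norm_div, norm_pow, norm_neg, norm_pow, Real.norm_of_nonneg hv.1.le,
      Real.norm_of_nonneg (by positivity : (0 : ℝ) ≤ n + 1), div_mul_eq_mul_div]
    have : 0 ≤ v ^ n := pow_nonneg hv.1.le n
    gcongr
    exact mul_le_of_le_one_left this (pow_le_one₀ (norm_nonneg _) hs)
  · filter_upwards [ae_ne_one] with v hne hv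
    exact (hlog v hv hne).summable
  · refine intervalIntegrable_neg_log_one_sub_div.congr_ae ?_
    rw [EventuallyEq, ae_restrict_iff' measurableSet_uIoc]
    filter_upwards [ae_ne_one] with v hne hv
    exact (hlog v hv hne).tsum_eq.symm
  · filter_upwards [ae_ne_one] with v hne hv
    rw [uIoc_of_le zero_le_one] at hv
    have h1 : v < 1 := lt_of_le_of_ne hv.2 hne
    have habs : |-(s * v)| < 1 := by
      rw [abs_neg, abs_mul, abs_of_pos hv.1]
      exact (mul_le_of_le_one_left hv.1.le hs).trans_lt h1
    have := ((Real.hasSum_pow_div_log_of_abs_lt_one habs).div_const v).neg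
    rw [sub_neg_eq_add, neg_div, neg_neg] at this
    refine this.congr_fun fun n => ?_
    have := hv.1.ne'
    rw [← neg_mul, mul_pow]
    field_simp
    ring

theorem hasSum_one_div_add_one_sq :
    HasSum (fun n : ℕ => 1 / ((n : ℝ) + 1) ^ 2) (Real.pi ^ 2 / 6) := by
  have h := (hasSum_nat_add_iff' 1).2 hasSum_zeta_two
  simpa using h

/-- The even terms of ζ(2) sum to ζ(2)/4 = π²/24; the odd ones supply the rest and enter with the
opposite sign. -/
theorem hasSum_alternating_one_div_add_one_sq :
    HasSum (fun n : ℕ => (-1) ^ (n + 1) / ((n : ℝ) + 1) ^ 2) (-(Real.pi ^ 2 / 12)) := by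
  have heven : HasSum (fun k : ℕ => 1 / ((2 * k : ℕ) : ℝ) ^ 2) (Real.pi ^ 2 / 24) := by
    have h := hasSum_zeta_two.div_const 4
    rw [div_div] at h
    norm_num at h
    refine h.congr_fun fun k => ?_
    push_cast
    rw [mul_pow, one_div, mul_inv]
    ring
  have hodd : Summable (fun k : ℕ => 1 / ((2 * k + 1 : ℕ) : ℝ) ^ 2) :=
    hasSum_zeta_two.summable.comp_injective (i := fun k : ℕ => 2 * k + 1)
      fun a b h => by simpa using h
  have hval : Real.pi ^ 2 / 24 + ∑' k : ℕ, 1 / ((2 * k + 1 : ℕ) : ℝ) ^ 2 = Real.pi ^ 2 / 6 :=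
    (HasSum.even_add_odd (f := fun n : ℕ => 1 / (n : ℝ) ^ 2) heven hodd.hasSum).unique
      hasSum_zeta_two
  have halt : HasSum (fun n : ℕ => (-1) ^ n / (n : ℝ) ^ 2)
      (Real.pi ^ 2 / 24 + -∑' k : ℕ, 1 / ((2 * k + 1 : ℕ) : ℝ) ^ 2) := by
    refine HasSum.even_add_odd (f := fun n : ℕ => (-1) ^ n / (n : ℝ) ^ 2) ?_ ?_
    · simpa using heven
    · refine hodd.hasSum.neg.congr_fun fun k => ?_
      rw [pow_succ, pow_mul]
      simp [neg_div]
  -- The dropped term n = 0 is a division by zero, hence 0.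
  have h := (hasSum_nat_add_iff' 1).2 halt
  have hv : Real.pi ^ 2 / 24 + -∑' k : ℕ, 1 / ((2 * k + 1 : ℕ) : ℝ) ^ 2
      - ∑ i ∈ Finset.range 1, (-1) ^ i / (i : ℝ) ^ 2 = -(Real.pi ^ 2 / 12) := by
    rw [Finset.sum_range_one]
    norm_num at hval ⊢
    linarith
  rw [hv] at h
  refine h.congr_fun fun n => ?_
  push_cast
  rfl

theorem integral_log_one_add_div :
    ∫ v in (0 : ℝ)..1, Real.log (1 + 1 * v) / v = Real.pi ^ 2 / 12 := by
  refine (hasSum_integral_log_one_add_mul_div (by simp)).unique ?_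
  simpa using hasSum_alternating_one_div_add_one_sq.neg

theorem integral_log_one_sub_div :
    ∫ v in (0 : ℝ)..1, Real.log (1 + -1 * v) / v = -(Real.pi ^ 2 / 6) := by
  refine (hasSum_integral_log_one_add_mul_div (by simp)).unique ?_
  simpa using hasSum_one_div_add_one_sq.neg

end LogIntegrals

/-! ### Limits and rates of the oscillatory integrals -/

section OscillatoryIntegral

theorem isBigO_one_div_tendsto {E : Type*} [NormedAddCommGroup E] {f : ℝ → E}
    (h : f =O[atTop] fun x : ℝ => 1 / x) : Tendsto f atTop (𝓝 0) :=
  h.trans_tendsto (by simpa using tendsto_inv_atTop_zero)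

theorem tendsto_ein_I_mul_sub_log :
    Tendsto (fun x : ℝ => ein (Complex.I * x) - Real.log x) atTop
      (𝓝 (Real.eulerMascheroniConstant + Complex.I * (Real.pi / 2))) := by
  simpa using (isBigO_one_div_tendsto ein_I_mul_sub_log_isBigO).add_const
    (Real.eulerMascheroniConstant + Complex.I * (Real.pi / 2) : ℂ)

theorem tendsto_ein_I_mul_mul_sub {b : ℝ} (hb : 0 < b) :
    Tendsto (fun x : ℝ => ein (Complex.I * (x * b : ℝ)) - ein (Complex.I * x)) atTop
      (𝓝 (Real.log b)) := by
  have h := ((tendsto_ein_I_mul_sub_log.comp (tendsto_id.atTop_mul_const hb)).sub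
    tendsto_ein_I_mul_sub_log).add_const (Real.log b : ℂ)
  rw [sub_self, zero_add] at h
  refine h.congr' ?_
  filter_upwards [eventually_gt_atTop 0] with x hx
  simp only [Function.comp, id]
  rw [Real.log_mul hx.ne' hb.ne']
  push_cast
  ring

theorem ein_I_mul_isBigO_log :
    (fun x : ℝ => ein (Complex.I * x)) =O[atTop] fun x : ℝ => Real.log x := by
  have h1 : (fun x : ℝ => ein (Complex.I * x) - Real.log x) =O[atTop] fun x : ℝ => Real.log x :=
    (tendsto_ein_I_mul_sub_log.isBigO_one ℝ).trans
      ((Real.isLittleO_const_log_atTop (c := (1 : ℝ))).isBigO)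
  have h2 : (fun x : ℝ => (Real.log x : ℂ)) =O[atTop] fun x : ℝ => Real.log x :=
    IsBigO.of_bound 1 (Eventually.of_forall fun x => by simp)
  simpa using h1.add h2

theorem intervalIntegral_swap_of_norm_le {E : Type*} [NormedAddCommGroup E] [NormedSpace ℝ E]
    {F : ℝ → ℝ → E} (hF : AEStronglyMeasurable F.uncurry) {a b c d : ℝ} (C : ℝ)
    (hC : ∀ x ∈ Ι a b, ∀ y ∈ Ι c d, ‖F x y‖ ≤ C) :
    ∫ x in a..b, ∫ y in c..d, F x y = ∫ y in c..d, ∫ x in a..b, F x y := by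
  refine intervalIntegral_intervalIntegral_swap (Measure.integrableOn_of_bounded (M := C) ?_ hF ?_)
  · rw [Measure.volume_eq_prod, Measure.prod_prod]
    simpa [uIoc] using ENNReal.mul_ne_top ENNReal.ofReal_ne_top ENNReal.ofReal_ne_top
  · rw [ae_restrict_iff' (measurableSet_uIoc.prod measurableSet_uIoc)]
    exact Eventually.of_forall fun p hp => hC p.1 hp.1 p.2 hp.2

/-- The integral `∫₀ˣ exp (-i y) Ein (i s y) / y dy`. -/
noncomputable def oscInt (s x : ℝ) : ℂ :=
  ∫ y in (0 : ℝ)..x, Complex.exp (-(Complex.I * y)) * ein (Complex.I * (s * y : ℝ)) / y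

theorem measurable_oscInt_integrand (s : ℝ) :
    Measurable fun y : ℝ => Complex.exp (-(Complex.I * y)) * ein (Complex.I * (s * y : ℝ)) / y := by
  fun_prop

theorem norm_ein_div_le (s y : ℝ) : ‖ein (Complex.I * (s * y : ℝ)) / y‖ ≤ |s| := by
  rw [norm_div, Complex.norm_real, Real.norm_eq_abs]
  refine div_le_of_le_mul₀ (abs_nonneg _) (abs_nonneg _) ?_
  rw [← abs_mul]
  exact norm_ein_I_mul_le _

theorem norm_oscInt_integrand_le (s y : ℝ) :
    ‖Complex.exp (-(Complex.I * y)) * ein (Complex.I * (s * y : ℝ)) / y‖ ≤ |s| := by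
  rw [mul_div_assoc, norm_mul, norm_exp_neg_I_mul, one_mul]
  exact norm_ein_div_le s y

theorem intervalIntegrable_oscInt (s a b : ℝ) : IntervalIntegrable
    (fun y : ℝ => Complex.exp (-(Complex.I * y)) * ein (Complex.I * (s * y : ℝ)) / y)
    volume a b :=
  intervalIntegrable_of_norm_le (measurable_oscInt_integrand s).aestronglyMeasurable |s|
    fun y _ => norm_oscInt_integrand_le s y

theorem hasDerivAt_oscInt (s : ℝ) {x : ℝ} (hx : x ≠ 0) :
    HasDerivAt (oscInt s)
      (Complex.exp (-(Complex.I * x)) * ein (Complex.I * (s * x : ℝ)) / x) x := by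
  refine intervalIntegral.integral_hasDerivAt_right (intervalIntegrable_oscInt s 0 x)
    (measurable_oscInt_integrand s).stronglyMeasurable.stronglyMeasurableAtFilter ?_
  have hx' : (x : ℂ) ≠ 0 := Complex.ofReal_ne_zero.2 hx
  exact ContinuousAt.div (by fun_prop) (by fun_prop) hx'

theorem norm_one_sub_exp_I_mul_div_le (b y : ℝ) :
    ‖(1 - Complex.exp (-(Complex.I * (b * y : ℝ)))) / y‖ ≤ |b| := by
  rw [norm_div, Complex.norm_real, Real.norm_eq_abs]
  refine div_le_of_le_mul₀ (abs_nonneg _) (abs_nonneg _) ?_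
  rw [← abs_mul]
  exact norm_one_sub_exp_I_mul_le _

theorem integral_one_sub_exp_I_mul_div (b x : ℝ) :
    ∫ y in (0 : ℝ)..x, (1 - Complex.exp (-(Complex.I * (b * y : ℝ)))) / y
      = ein (Complex.I * (x * b : ℝ)) := by
  have h := integral_one_sub_exp_div (Complex.I * b) x
  rw [mul_assoc, ← Complex.ofReal_mul, mul_comm b x] at h
  rw [← h]
  simp [mul_assoc]

theorem intervalIntegrable_one_sub_exp_I_mul_div (b x y : ℝ) :
    IntervalIntegrable (fun y : ℝ => (1 - Complex.exp (-(Complex.I * (b * y : ℝ)))) / (y : ℂ))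
      volume x y :=
  intervalIntegrable_of_norm_le (Measurable.aestronglyMeasurable (by fun_prop)) |b|
    fun y _ => norm_one_sub_exp_I_mul_div_le b y

/-- Ein(isy) is expanded as an integral over v and the order exchanged, the double integrand being
bounded by |s|. Then e^{-iy}(1 - e^{-isvy}) = (1 - e^{-i(1+sv)y}) - (1 - e^{-iy}), and each piece
integrates to an Ein. -/
theorem oscInt_eq_integral (s x : ℝ) :
    oscInt s x = ∫ v in (0 : ℝ)..1,
      (ein (Complex.I * (x * (1 + s * v) : ℝ)) - ein (Complex.I * x)) / v := by
  have h1 : oscInt s x = ∫ y in (0 : ℝ)..x, ∫ v in (0 : ℝ)..1,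
      Complex.exp (-(Complex.I * y)) * ((1 - Complex.exp (-(Complex.I * (s * y * v : ℝ)))) / v)
        / y := by
    refine intervalIntegral.integral_congr fun y _ => ?_
    rw [intervalIntegral.integral_div, intervalIntegral.integral_const_mul, ein]
    simp [mul_assoc]
  rw [h1, intervalIntegral_swap_of_norm_le (Measurable.aestronglyMeasurable
    (by unfold Function.uncurry; fun_prop)) |s|]
  · refine intervalIntegral.integral_congr fun v _ => ?_
    rw [← integral_one_sub_exp_I_mul_div, show Complex.I * (x : ℂ) = Complex.I * (x * 1 : ℝ) by simp,
      ← integral_one_sub_exp_I_mul_div, ← intervalIntegral.integral_sub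
      (intervalIntegrable_one_sub_exp_I_mul_div _ _ _)
      (intervalIntegrable_one_sub_exp_I_mul_div _ _ _), ← intervalIntegral.integral_div]
    refine intervalIntegral.integral_congr fun y _ => ?_
    have he : Complex.exp (-(Complex.I * ((1 + s * v) * y : ℝ)))
        = Complex.exp (-(Complex.I * y)) * Complex.exp (-(Complex.I * (s * y * v : ℝ))) := by
      rw [← Complex.exp_add]
      congr 1
      push_cast
      ring
    rw [he, one_mul]
    ring
  · intro y _ v _
    rw [mul_div_assoc, norm_mul, norm_exp_neg_I_mul, one_mul, div_right_comm, norm_div,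
      Complex.norm_real, Real.norm_eq_abs, mul_right_comm]
    exact div_le_of_le_mul₀ (abs_nonneg _) (abs_nonneg _) (by
      rw [← abs_mul]
      have := norm_one_sub_exp_I_mul_div_le (s * v) y
      rwa [abs_mul] at this ⊢)

/-- The difference of Ein values tends to log(1 + sv) and is at most 2|log(1 + sv)| ≤ -2 log(1 - v),
uniformly in x. -/
theorem tendsto_oscInt {s : ℝ} (hs : |s| ≤ 1) :
    Tendsto (oscInt s) atTop
      (𝓝 ((∫ v in (0 : ℝ)..1, Real.log (1 + s * v) / v : ℝ) : ℂ)) := by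
  have hpos : ∀ v ∈ Ι (0 : ℝ) 1, v ≠ 1 → v < 1 ∧ 0 < 1 + s * v := by
    intro v hv hne
    rw [uIoc_of_le zero_le_one] at hv
    have h1 : v < 1 := lt_of_le_of_ne hv.2 hne
    exact ⟨h1, by nlinarith [(abs_le.1 hs).1, hv.1]⟩
  rw [← intervalIntegral.integral_ofReal]
  simp_rw [Complex.ofReal_div]
  rw [show oscInt s = _ from funext (oscInt_eq_integral s)]
  refine intervalIntegral.tendsto_integral_filter_of_dominated_convergence
    (fun v => 2 * (-Real.log (1 - v) / v)) ?_ ?_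
    (intervalIntegrable_neg_log_one_sub_div.const_mul 2) ?_
  · exact Eventually.of_forall fun x => Measurable.aestronglyMeasurable (by fun_prop)
  · filter_upwards [eventually_gt_atTop 0] with x hx
    filter_upwards [ae_ne_one] with v hne hv
    obtain ⟨h1, h2⟩ := hpos v hv hne
    rw [uIoc_of_le zero_le_one] at hv
    rw [norm_div, Complex.norm_real, Real.norm_of_nonneg hv.1.le, ← mul_div_assoc]
    refine div_le_div_of_nonneg_right ?_ hv.1.le
    refine (norm_ein_I_mul_sub_le_abs_log hx (mul_pos hx h2)).trans ?_
    rw [mul_div_cancel_left₀ _ hx.ne']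
    gcongr
    exact abs_log_one_add_mul_le hs hv.1 h1
  · filter_upwards [ae_ne_one] with v hne hv
    exact (tendsto_ein_I_mul_mul_sub (hpos v hv hne).2).div_const _

theorem tendsto_oscInt_one : Tendsto (oscInt 1) atTop (𝓝 (Real.pi ^ 2 / 12 : ℂ)) := by
  have := tendsto_oscInt (s := 1) (by simp)
  rw [integral_log_one_add_div] at this
  simpa using this

theorem tendsto_oscInt_neg_one : Tendsto (oscInt (-1)) atTop (𝓝 (-(Real.pi ^ 2 / 6) : ℂ)) := by
  have := tendsto_oscInt (s := -1) (by simp)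
  rw [integral_log_one_sub_div] at this
  simpa using this

theorem hasDerivAt_ein_I_mul_mul {s x : ℝ} (hs : s ≠ 0) (hx : x ≠ 0) :
    HasDerivAt (fun x : ℝ => ein (Complex.I * (s * x : ℝ)))
      ((1 - Complex.exp (-(Complex.I * (s * x : ℝ)))) / x) x := by
  refine ((hasDerivAt_ein_I_mul (mul_ne_zero hs hx)).scomp x
    ((hasDerivAt_id' x).const_mul s)).congr_deriv ?_
  have hs' : (s : ℂ) ≠ 0 := Complex.ofReal_ne_zero.2 hs
  rw [mul_one, Complex.real_smul, Complex.ofReal_mul, ← mul_div_assoc, mul_div_mul_left _ _ hs']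

theorem norm_ein_I_mul_mul {s : ℝ} (hs : |s| = 1) (x : ℝ) :
    ‖ein (Complex.I * (s * x : ℝ))‖ = ‖ein (Complex.I * x)‖ := by
  rcases eq_or_eq_neg_of_abs_eq hs with rfl | rfl
  · rw [one_mul]
  · rw [← Complex.norm_conj (ein (Complex.I * x)), conj_ein]
    simp

/-- One integration by parts: subtracting i e^{-ix} Ein(isx)/x leaves a derivative of size log x /
x². With |s| = 1, Ein(isx) is Ein(ix) or its conjugate, hence O(log x). -/
theorem exists_oscInt_sub_isBigO {s : ℝ} (hs : |s| = 1) :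
    ∃ c, (fun x => oscInt s x - c) =O[atTop] fun x : ℝ => Real.log x / x := by
  have hs0 : s ≠ 0 := by rintro rfl; simp at hs
  have hE : (fun x : ℝ => ein (Complex.I * (s * x : ℝ))) =O[atTop] fun x : ℝ => Real.log x :=
    (ein_I_mul_isBigO_log.norm_left.congr_left fun x => (norm_ein_I_mul_mul hs x).symm).of_norm_left
  have hlog : (fun _ : ℝ => (1 : ℝ)) =O[atTop] fun x : ℝ => Real.log x :=
    Real.isLittleO_const_log_atTop.isBigO
  have hexp : (fun x : ℝ => Complex.I * Complex.exp (-(Complex.I * x))) =O[atTop]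
      fun _ : ℝ => (1 : ℝ) :=
    IsBigO.of_bound 1 (Eventually.of_forall fun x => by simp [norm_exp_neg_I_mul])
  have hinv : ∀ n : ℕ, (fun x : ℝ => (1 / (x : ℂ) ^ n)) =O[atTop] fun x : ℝ => 1 / x ^ n :=
    fun n => IsBigO.of_bound 1 (Eventually.of_forall fun x => by simp)
  have hB : (fun x : ℝ => 1 - Complex.exp (-(Complex.I * (s * x : ℝ)))) =O[atTop]
      fun x : ℝ => Real.log x := by
    refine IsBigO.trans (IsBigO.of_bound 2 (Eventually.of_forall fun x => ?_)) hlog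
    refine (norm_sub_le _ _).trans ?_
    rw [norm_exp_neg_I_mul]
    norm_num
  have key : ∃ c, (fun x : ℝ => oscInt s x
      - Complex.I * Complex.exp (-(Complex.I * x)) * ein (Complex.I * (s * x : ℝ)) / x - c)
      =O[atTop] fun x : ℝ => Real.log x / x := by
    refine exists_isBigO_log_div_of_deriv
      (φ' := fun x : ℝ => Complex.I * Complex.exp (-(Complex.I * x))
        * (ein (Complex.I * (s * x : ℝ)) - (1 - Complex.exp (-(Complex.I * (s * x : ℝ)))))
        * (1 / (x : ℂ) ^ 2)) ?_ ?_
    · filter_upwards [eventually_gt_atTop 0] with x hx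
      have hx' : (x : ℂ) ≠ 0 := Complex.ofReal_ne_zero.2 hx.ne'
      have h1 : HasDerivAt (fun y : ℝ => (y : ℂ)) 1 x := Complex.ofRealCLM.hasDerivAt (x := x)
      refine ((hasDerivAt_oscInt s hx.ne').fun_sub
        (((((h1.const_mul Complex.I).fun_neg.cexp).const_mul Complex.I).fun_mul
          (hasDerivAt_ein_I_mul_mul hs0 hx.ne')).fun_div h1 hx')).congr_deriv ?_
      field_simp
      linear_combination (x * ein (Complex.I * (s * x : ℝ))) * Complex.I_sq
    · refine ((hexp.mul (hE.sub hB)).mul (hinv 2)).congr_right fun x => ?_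
      ring
  obtain ⟨c, hc⟩ := key
  refine ⟨c, ?_⟩
  have h2 : (fun x : ℝ => Complex.I * Complex.exp (-(Complex.I * x))
      * ein (Complex.I * (s * x : ℝ)) / (x : ℂ)) =O[atTop] fun x : ℝ => Real.log x / x := by
    refine ((hexp.mul hE).mul (hinv 1)).congr (fun x => ?_) fun x => ?_
    · rw [pow_one, mul_one_div]
    · rw [pow_one, mul_one_div, one_mul]
  exact (hc.add h2).congr_left fun x => by ring

theorem oscInt_sub_isBigO {s : ℝ} {c : ℂ} (hs : |s| = 1) (hc : Tendsto (oscInt s) atTop (𝓝 c)) :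
    (fun x => oscInt s x - c) =O[atTop] fun x : ℝ => Real.log x / x := by
  obtain ⟨d, hd⟩ := exists_oscInt_sub_isBigO hs
  have h : Tendsto (oscInt s) atTop (𝓝 d) := by
    simpa using (hd.trans_tendsto (by simpa using tendsto_log_pow_div_atTop 1)).add_const d
  rwa [tendsto_nhds_unique hc h]

end OscillatoryIntegral

/-! ### Absolute convergence and reduction to a single integral -/

section TripleIntegral

/-- The product form exhibits three small factors, which compensate the denominator xyz on 0 < z ≤ y
≤ x. -/
theorem sin_combination_eq (x y z : ℝ) :
    Real.sin x + Real.sin (x - y) - Real.sin (x - z) - Real.sin (x - y + z)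
      = -4 * (Real.sin (x - y / 2) * Real.sin ((y - z) / 2) * Real.sin (z / 2)) := by
  have h1 : Real.sin x + Real.sin (x - y) = 2 * Real.sin (x - y / 2) * Real.cos (y / 2) := by
    rw [Real.sin_add_sin]; ring_nf
  have h2 : Real.sin (x - z) + Real.sin (x - y + z)
      = 2 * Real.sin (x - y / 2) * Real.cos (y / 2 - z) := by
    rw [Real.sin_add_sin]; ring_nf
  have h3 : Real.cos (y / 2) - Real.cos (y / 2 - z)
      = -2 * Real.sin ((y - z) / 2) * Real.sin (z / 2) := by
    rw [Real.cos_sub_cos]; ring_nf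
  linear_combination h1 - h2 + 2 * Real.sin (x - y / 2) * h3

theorem measurable_tripleIntegrand :
    Measurable fun p : ℝ × ℝ × ℝ => tripleIntegrand p.1 p.2.1 p.2.2 := by
  unfold tripleIntegrand
  fun_prop

theorem abs_tripleIntegrand_le {x y z : ℝ} (hz : 0 < z) (hzy : z ≤ y) (hyx : y ≤ x) :
    |tripleIntegrand x y z| ≤ 1 := by
  have hy : 0 < y := hz.trans_le hzy
  have hx : 0 < x := hy.trans_le hyx
  have h1 : |Real.sin (x - y / 2)| ≤ x :=
    Real.abs_sin_le_abs.trans (abs_le.2 ⟨by linarith, by linarith⟩)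
  have h2 : |Real.sin ((y - z) / 2)| ≤ y / 2 :=
    Real.abs_sin_le_abs.trans (abs_le.2 ⟨by linarith, by linarith⟩)
  have h3 : |Real.sin (z / 2)| ≤ z / 2 :=
    Real.abs_sin_le_abs.trans (abs_le.2 ⟨by linarith, by linarith⟩)
  have h : tripleIntegrand x y z
      = -4 * (Real.sin (x - y / 2) * Real.sin ((y - z) / 2) * Real.sin (z / 2)) / (x * y * z) := by
    rw [tripleIntegrand, sin_combination_eq]
    field_simp
  rw [h, abs_div, abs_of_pos (by positivity : 0 < x * y * z), div_le_one (by positivity), abs_mul,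
    abs_mul, abs_mul, abs_neg, abs_of_pos (by norm_num : (0 : ℝ) < 4)]
  calc 4 * (|Real.sin (x - y / 2)| * |Real.sin ((y - z) / 2)| * |Real.sin (z / 2)|)
      ≤ 4 * (x * (y / 2) * (z / 2)) := by gcongr
    _ = x * y * z := by ring

theorem integrableOn_tripleIntegrand (t : ℝ) :
    IntegrableOn (fun p : ℝ × ℝ × ℝ => tripleIntegrand p.1 p.2.1 p.2.2)
      {p : ℝ × ℝ × ℝ | 0 < p.2.2 ∧ p.2.2 < p.2.1 ∧ p.2.1 < p.1 ∧ p.1 < t} := by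
  have hmeas : MeasurableSet
      {p : ℝ × ℝ × ℝ | 0 < p.2.2 ∧ p.2.2 < p.2.1 ∧ p.2.1 < p.1 ∧ p.1 < t} := by
    have m1 : Measurable fun p : ℝ × ℝ × ℝ => p.1 := by fun_prop
    have m2 : Measurable fun p : ℝ × ℝ × ℝ => p.2.1 := by fun_prop
    have m3 : Measurable fun p : ℝ × ℝ × ℝ => p.2.2 := by fun_prop
    exact (measurableSet_lt measurable_const m3).inter ((measurableSet_lt m3 m2).inter
      ((measurableSet_lt m2 m1).inter (measurableSet_lt m1 measurable_const)))
  have hsub : {p : ℝ × ℝ × ℝ | 0 < p.2.2 ∧ p.2.2 < p.2.1 ∧ p.2.1 < p.1 ∧ p.1 < t}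
      ⊆ Icc (0, 0, 0) (t, t, t) := by
    rintro ⟨x, y, z⟩ ⟨h1, h2, h3, h4⟩
    simp only at h1 h2 h3 h4
    exact ⟨⟨by simp; linarith, by simp; linarith, by simp; linarith⟩,
      by simp; linarith, by simp; linarith, by simp; linarith⟩
  refine Measure.integrableOn_of_bounded (M := 1)
    ((measure_mono hsub).trans_lt isCompact_Icc.measure_lt_top).ne
    measurable_tripleIntegrand.aestronglyMeasurable ?_
  rw [ae_restrict_iff' hmeas]
  exact Eventually.of_forall fun p hp => abs_tripleIntegrand_le hp.1 hp.2.1.le hp.2.2.1.le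

/-- The double integral of the complexified integrand over `0 < z < y < x`. -/
noncomputable def innerDouble (x : ℝ) : ℂ :=
  ein (Complex.I * x) ^ 2 / 2 + oscInt 1 x + oscInt (-1) x

/-- The derivative of Ein(iy)²/2 is Ein(iy)(1 - e^{-iy})/y; its oscillating half is the integrand of
`oscInt 1`. -/
theorem integral_ein_I_mul_div {x : ℝ} (hx : 0 ≤ x) :
    ∫ y in (0 : ℝ)..x, ein (Complex.I * y) / y = ein (Complex.I * x) ^ 2 / 2 + oscInt 1 x := by
  have hint : IntervalIntegrable (fun y : ℝ => ein (Complex.I * y) / (y : ℂ)) volume 0 x :=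
    intervalIntegrable_of_norm_le (Measurable.aestronglyMeasurable (by fun_prop)) |1|
      fun y _ => by simpa using norm_ein_div_le 1 y
  have hosc : IntervalIntegrable
      (fun y : ℝ => Complex.exp (-(Complex.I * y)) * ein (Complex.I * y) / (y : ℂ)) volume 0 x := by
    simpa using intervalIntegrable_oscInt 1 0 x
  have h := intervalIntegral.integral_eq_sub_of_hasDerivAt_of_le hx
    (f := fun y : ℝ => ein (Complex.I * y) ^ 2 / 2)
    (f' := fun y : ℝ => ein (Complex.I * y) / y
      - Complex.exp (-(Complex.I * y)) * ein (Complex.I * y) / y)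
    (Continuous.continuousOn (by fun_prop)) ?_ (hint.sub hosc)
  · rw [intervalIntegral.integral_sub hint hosc] at h
    simp only [oscInt, one_mul]
    simp [ein] at h ⊢
    linear_combination h
  · intro y hy
    refine (((hasDerivAt_ein_I_mul hy.1.ne').fun_pow 2).div_const 2).congr_deriv ?_
    simp
    ring

/-- The sines are paired as sin x - sin(x - z) and sin(x - y) - sin(x - y + z), so that each pair
integrates over z to a value of Ein. -/
theorem tripleIntegrand_eq_im (x y z : ℝ) :
    tripleIntegrand x y z = (((1 / (x * y) : ℝ) : ℂ) * Complex.exp (Complex.I * x)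
      * ((1 - Complex.exp (-(Complex.I * z))) / z
        + Complex.exp (-(Complex.I * y)) * ((1 - Complex.exp (-(-Complex.I * z))) / z))).im := by
  have hexp : ∀ a : ℝ, (Complex.exp (Complex.I * a)).im = Real.sin a := fun a => by
    rw [mul_comm, Complex.exp_ofReal_mul_I_im]
  have h : ((1 / (x * y) : ℝ) : ℂ) * Complex.exp (Complex.I * x)
      * ((1 - Complex.exp (-(Complex.I * z))) / z
        + Complex.exp (-(Complex.I * y)) * ((1 - Complex.exp (-(-Complex.I * z))) / z))
      = ((1 / (x * y * z) : ℝ) : ℂ) * (Complex.exp (Complex.I * x)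
        + Complex.exp (Complex.I * (x - y : ℝ)) - Complex.exp (Complex.I * (x - z : ℝ))
        - Complex.exp (Complex.I * (x - y + z : ℝ))) := by
    have e1 : Complex.exp (Complex.I * (x - y : ℝ))
        = Complex.exp (Complex.I * x) * Complex.exp (-(Complex.I * y)) := by
      rw [← Complex.exp_add]; push_cast; ring_nf
    have e2 : Complex.exp (Complex.I * (x - z : ℝ))
        = Complex.exp (Complex.I * x) * Complex.exp (-(Complex.I * z)) := by
      rw [← Complex.exp_add]; push_cast; ring_nf
    have e3 : Complex.exp (Complex.I * (x - y + z : ℝ)) = Complex.exp (Complex.I * x)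
        * Complex.exp (-(Complex.I * y)) * Complex.exp (-(-Complex.I * z)) := by
      rw [← Complex.exp_add, ← Complex.exp_add]; push_cast; ring_nf
    rw [e1, e2, e3]
    push_cast
    ring
  rw [h, Complex.im_ofReal_mul]
  simp only [Complex.sub_im, Complex.add_im, hexp]
  rw [tripleIntegrand]
  ring

theorem integral_im_const_mul {f : ℝ → ℂ} {a b : ℝ} (c : ℂ) (hf : IntervalIntegrable f volume a b) :
    ∫ x in a..b, (c * f x).im = (c * ∫ x in a..b, f x).im := by
  rw [← intervalIntegral.integral_const_mul]
  exact Complex.imCLM.intervalIntegral_comp_comm (hf.const_mul c)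

theorem integral_tripleIntegrand (x y : ℝ) :
    ∫ z in (0 : ℝ)..y, tripleIntegrand x y z
      = (((1 / x : ℝ) : ℂ) * Complex.exp (Complex.I * x) * (ein (Complex.I * y) / y
        + Complex.exp (-(Complex.I * y)) * ein (Complex.I * (-1 * y : ℝ)) / y)).im := by
  have h1 : IntervalIntegrable (fun z : ℝ => (1 - Complex.exp (-(Complex.I * z))) / (z : ℂ))
      volume 0 y := by simpa using intervalIntegrable_one_sub_exp_I_mul_div 1 0 y
  have h2 : IntervalIntegrable (fun z : ℝ => (1 - Complex.exp (-(-Complex.I * z))) / (z : ℂ))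
      volume 0 y := by simpa using intervalIntegrable_one_sub_exp_I_mul_div (-1) 0 y
  simp_rw [tripleIntegrand_eq_im]
  rw [integral_im_const_mul _ (h1.add (h2.const_mul _)),
    intervalIntegral.integral_add h1 (h2.const_mul _), intervalIntegral.integral_const_mul,
    integral_one_sub_exp_div, integral_one_sub_exp_div]
  congr 1
  push_cast
  rw [neg_mul, neg_mul, one_mul, mul_neg]
  ring

theorem tripleSine_eq_integral {t : ℝ} (ht : 0 ≤ t) :
    tripleSine t
      = ∫ x in (0 : ℝ)..t, (Complex.exp (Complex.I * x) * innerDouble x / x).im := by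
  refine intervalIntegral.integral_congr_ae (Eventually.of_forall fun x hx => ?_)
  rw [uIoc_of_le ht] at hx
  have h1 : IntervalIntegrable (fun y : ℝ => ein (Complex.I * y) / (y : ℂ)) volume 0 x :=
    intervalIntegrable_of_norm_le (Measurable.aestronglyMeasurable (by fun_prop)) |1|
      fun y _ => by simpa using norm_ein_div_le 1 y
  simp_rw [integral_tripleIntegrand]
  rw [integral_im_const_mul _ (h1.add (intervalIntegrable_oscInt (-1) 0 x)),
    intervalIntegral.integral_add h1 (intervalIntegrable_oscInt (-1) 0 x),
    integral_ein_I_mul_div hx.1.le, innerDouble]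
  congr 1
  rw [oscInt, oscInt]
  push_cast
  ring

theorem hasDerivAt_innerDouble {x : ℝ} (hx : x ≠ 0) :
    HasDerivAt innerDouble (ein (Complex.I * x) / x
      + Complex.exp (-(Complex.I * x)) * ein (Complex.I * (-1 * x : ℝ)) / x) x := by
  refine (((((hasDerivAt_ein_I_mul hx).fun_pow 2).div_const 2).fun_add
    (hasDerivAt_oscInt 1 hx)).fun_add (hasDerivAt_oscInt (-1) hx)).congr_deriv ?_
  simp
  ring

theorem norm_oscInt_le (s x : ℝ) : ‖oscInt s x‖ ≤ |s| * |x| := by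
  simpa [oscInt] using intervalIntegral.norm_integral_le_of_norm_le_const (a := 0) (b := x)
    fun y _ => norm_oscInt_integrand_le s y

@[fun_prop]
theorem continuous_oscInt (s : ℝ) : Continuous (oscInt s) :=
  intervalIntegral.continuous_primitive (intervalIntegrable_oscInt s) 0

@[fun_prop]
theorem continuous_innerDouble : Continuous innerDouble := by
  unfold innerDouble
  fun_prop

/-- The factor |x| keeps e^{ix} G(x)/x bounded at the origin. -/
theorem norm_innerDouble_le (x : ℝ) : ‖innerDouble x‖ ≤ (|x| / 2 + 2) * |x| := by
  have h1 := norm_ein_I_mul_le x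
  have h2 := norm_oscInt_le 1 x
  have h3 := norm_oscInt_le (-1) x
  have h4 : ‖ein (Complex.I * x) ^ 2 / 2‖ ≤ |x| ^ 2 / 2 := by
    rw [norm_div, norm_pow, RCLike.norm_ofNat]
    gcongr
  rw [abs_neg] at h3
  rw [abs_one, one_mul] at h2 h3
  have := norm_add₃_le (a := ein (Complex.I * x) ^ 2 / 2) (b := oscInt 1 x) (c := oscInt (-1) x)
  rw [innerDouble]
  linarith

theorem norm_exp_I_mul (x : ℝ) : ‖Complex.exp (Complex.I * x)‖ = 1 := by
  rw [mul_comm, Complex.norm_exp_ofReal_mul_I]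

theorem hasDerivAt_tripleSine {t : ℝ} (ht : 0 < t) :
    HasDerivAt tripleSine (Complex.exp (Complex.I * t) * innerDouble t / t).im t := by
  have hmeas : Measurable fun x : ℝ => (Complex.exp (Complex.I * x) * innerDouble x / x).im := by
    have := continuous_innerDouble.measurable
    fun_prop
  have h : HasDerivAt
      (fun t : ℝ => ∫ x in (0 : ℝ)..t, (Complex.exp (Complex.I * x) * innerDouble x / x).im)
      (Complex.exp (Complex.I * t) * innerDouble t / t).im t := by
    refine intervalIntegral.integral_hasDerivAt_right ?_
      hmeas.stronglyMeasurable.stronglyMeasurableAtFilter ?_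
    · refine intervalIntegrable_of_norm_le hmeas.aestronglyMeasurable (t / 2 + 2) fun x hx => ?_
      rw [uIoc_of_le ht.le] at hx
      rw [Real.norm_eq_abs]
      refine (Complex.abs_im_le_norm _).trans ?_
      rw [norm_div, norm_mul, norm_exp_I_mul, one_mul, Complex.norm_real, Real.norm_eq_abs]
      refine div_le_of_le_mul₀ (abs_nonneg _) (by positivity) ((norm_innerDouble_le x).trans ?_)
      gcongr
      rw [abs_of_pos hx.1]
      exact hx.2
    · have ht' : (t : ℂ) ≠ 0 := Complex.ofReal_ne_zero.2 ht.ne'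
      exact Complex.continuous_im.continuousAt.comp
        (ContinuousAt.div (by fun_prop) (by fun_prop) ht')
  refine h.congr_of_eventuallyEq ?_
  filter_upwards [eventually_gt_nhds ht] with x hx
  exact tripleSine_eq_integral hx.le

end TripleIntegral

/-! ### Vanishing of the triple integral at infinity -/

section Vanishing

/-- The integral over `0 < x < t` of the integrand of `tripleSine` in the coordinates
`(x, y / x, z / y)`. -/
noncomputable def unitKernel (t u v : ℝ) : ℝ :=
  (ein (Complex.I * t) + ein (Complex.I * (t * (1 - u) : ℝ)) - ein (Complex.I * (t * (1 - u * v) : ℝ))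
    - ein (Complex.I * (t * (1 - u + u * v) : ℝ))).im / (u * v)

theorem integral_eq_mul_integral_unit (f : ℝ → ℝ) (y : ℝ) :
    ∫ z in (0 : ℝ)..y, f z = ∫ v in (0 : ℝ)..1, y * f (y * v) := by
  have h := intervalIntegral.smul_integral_comp_mul_left (a := 0) (b := 1) f y
  rw [mul_zero, mul_one] at h
  rw [← h, intervalIntegral.integral_const_mul, smul_eq_mul]

theorem measurable_intervalIntegral_right {α : Type*} [MeasurableSpace α] {F : α → ℝ → ℝ}
    (hF : Measurable F.uncurry) (a b : ℝ) : Measurable fun x => ∫ v in a..b, F x v := by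
  have h : ∀ a b : ℝ, Measurable fun x => ∫ v in Ioc a b, F x v := fun a b =>
    (hF.stronglyMeasurable.integral_prod_right (ν := volume.restrict (Ioc a b))).measurable
  exact (h a b).sub (h b a)

theorem tripleSine_eq_integral_unit (t : ℝ) :
    tripleSine t = ∫ x in (0 : ℝ)..t, ∫ u in (0 : ℝ)..1, ∫ v in (0 : ℝ)..1,
      x * (x * u * tripleIntegrand x (x * u) (x * u * v)) := by
  refine intervalIntegral.integral_congr fun x _ => ?_
  rw [integral_eq_mul_integral_unit]
  refine intervalIntegral.integral_congr fun u _ => ?_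
  rw [integral_eq_mul_integral_unit, intervalIntegral.integral_const_mul,
    intervalIntegral.integral_const_mul, intervalIntegral.integral_const_mul]

theorem abs_unit_integrand_le {t x u v : ℝ} (hx : x ∈ Ioc 0 t) (hu : u ∈ Ioc (0 : ℝ) 1)
    (hv : v ∈ Ioc (0 : ℝ) 1) :
    ‖x * (x * u * tripleIntegrand x (x * u) (x * u * v))‖ ≤ t ^ 2 := by
  have h0 : 0 < x * u := mul_pos hx.1 hu.1
  have h := abs_tripleIntegrand_le (x := x) (y := x * u) (z := x * u * v)
    (mul_pos h0 hv.1) (mul_le_of_le_one_right h0.le hv.2) (mul_le_of_le_one_right hx.1.le hu.2)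
  rw [Real.norm_eq_abs, abs_mul, abs_mul, abs_of_pos h0, abs_of_pos hx.1]
  have h1 : x * u ≤ t := (mul_le_of_le_one_right hx.1.le hu.2).trans hx.2
  calc x * (x * u * |tripleIntegrand x (x * u) (x * u * v)|) ≤ t * (t * 1) := by
        gcongr
        · exact hx.1.le.trans hx.2
        · exact hx.2
        · exact hx.1.le.trans hx.2
    _ = t ^ 2 := by ring

theorem integral_unit_integrand (t : ℝ) {u v : ℝ} (hu : u ≠ 0) (hv : v ≠ 0) :
    ∫ x in (0 : ℝ)..t, x * (x * u * tripleIntegrand x (x * u) (x * u * v)) = unitKernel t u v := by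
  have hI := intervalIntegrable_one_sub_exp_I_mul_div
  have h1 : ∀ x : ℝ, x * (x * u * tripleIntegrand x (x * u) (x * u * v))
      = (((1 / (u * v) : ℝ) : ℂ) * ((1 - Complex.exp (-(Complex.I * (1 * x : ℝ)))) / x
        + (1 - Complex.exp (-(Complex.I * ((1 - u) * x : ℝ)))) / x
        - (1 - Complex.exp (-(Complex.I * ((1 - u * v) * x : ℝ)))) / x
        - (1 - Complex.exp (-(Complex.I * ((1 - u + u * v) * x : ℝ)))) / x)).im := by
    intro x
    have him : ∀ a : ℝ, ((1 - Complex.exp (-(Complex.I * a))) / x).im = Real.sin a / x := by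
      intro a
      rw [Complex.div_ofReal_im, ← mul_neg, ← Complex.ofReal_neg, mul_comm Complex.I,
        Complex.sub_im, Complex.exp_ofReal_mul_I_im]
      simp
    rw [Complex.im_ofReal_mul]
    simp only [Complex.sub_im, Complex.add_im, him]
    rcases eq_or_ne x 0 with rfl | hx
    · simp
    rw [tripleIntegrand, one_mul, show x - x * u = (1 - u) * x by ring,
      show x - x * u * v = (1 - u * v) * x by ring,
      show (1 - u) * x + x * u * v = (1 - u + u * v) * x by ring]
    field_simp
  simp_rw [h1]
  rw [integral_im_const_mul _ ((((hI 1 0 t).add (hI (1 - u) 0 t)).sub (hI (1 - u * v) 0 t)).sub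
    (hI (1 - u + u * v) 0 t)), intervalIntegral.integral_sub (((hI 1 0 t).add
    (hI (1 - u) 0 t)).sub (hI (1 - u * v) 0 t)) (hI (1 - u + u * v) 0 t),
    intervalIntegral.integral_sub ((hI 1 0 t).add (hI (1 - u) 0 t)) (hI (1 - u * v) 0 t),
    intervalIntegral.integral_add (hI 1 0 t) (hI (1 - u) 0 t)]
  simp_rw [integral_one_sub_exp_I_mul_div]
  rw [Complex.im_ofReal_mul, unitKernel, mul_one]
  ring

/-- After y = xu, z = xuv the region is a box on which the integrand is bounded by t², so x can be
moved innermost by two exchanges. -/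
theorem tripleSine_eq_integral_unitKernel {t : ℝ} (ht : 0 ≤ t) :
    tripleSine t = ∫ u in (0 : ℝ)..1, ∫ v in (0 : ℝ)..1, unitKernel t u v := by
  have hm : Measurable fun p : ℝ × ℝ × ℝ =>
      p.1 * (p.1 * p.2.1 * tripleIntegrand p.1 (p.1 * p.2.1) (p.1 * p.2.1 * p.2.2)) := by
    unfold tripleIntegrand
    fun_prop
  rw [tripleSine_eq_integral_unit, intervalIntegral_swap_of_norm_le (C := t ^ 2)]
  · refine intervalIntegral.integral_congr_ae (Eventually.of_forall fun u hu => ?_)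
    rw [uIoc_of_le zero_le_one] at hu
    rw [intervalIntegral_swap_of_norm_le (C := t ^ 2)]
    · refine intervalIntegral.integral_congr_ae (Eventually.of_forall fun v hv => ?_)
      rw [uIoc_of_le zero_le_one] at hv
      exact integral_unit_integrand t hu.1.ne' hv.1.ne'
    · exact (hm.comp (f := fun p : ℝ × ℝ => (p.1, u, p.2)) (by fun_prop)).aestronglyMeasurable
    · intro x hx v hv
      rw [uIoc_of_le ht] at hx
      rw [uIoc_of_le zero_le_one] at hv
      exact abs_unit_integrand_le hx hu hv
  · refine (measurable_intervalIntegral_right (α := ℝ × ℝ)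
      (F := fun p v => p.1 * (p.1 * p.2 * tripleIntegrand p.1 (p.1 * p.2) (p.1 * p.2 * v)))
      ?_ 0 1).aestronglyMeasurable
    exact hm.comp (f := fun p : (ℝ × ℝ) × ℝ => (p.1.1, p.1.2, p.2)) (by fun_prop)
  · intro x hx u hu
    rw [uIoc_of_le ht] at hx
    rw [uIoc_of_le zero_le_one] at hu
    have := intervalIntegral.norm_integral_le_of_norm_le_const (a := (0 : ℝ)) (b := 1) (C := t ^ 2)
      (f := fun v => x * (x * u * tripleIntegrand x (x * u) (x * u * v))) fun v hv => by
        rw [uIoc_of_le zero_le_one] at hv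
        exact abs_unit_integrand_le hx hu hv
    simpa using this

/-- The argument 1 is paired with 1 - uv, and 1 - u with 1 - u + uv. Both ratios are at most 1 +
uv/(1 - u), so each pair contributes at most 2 · 2√(uv/(1 - u)), whence the 8. The factor 1/√(1 - v)
is slack that makes the bound a product of two beta densities. -/
theorem abs_unitKernel_le {t u v : ℝ} (ht : 0 < t) (hu0 : 0 < u) (hu1 : u < 1) (hv0 : 0 < v)
    (hv1 : v < 1) :
    |unitKernel t u v| ≤ 8 * (1 / (√u * √(1 - u))) * (1 / (√v * √(1 - v))) := by
  have huv : 0 < u * v := mul_pos hu0 hv0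
  have hu : 0 < 1 - u := by linarith
  have huv1 : u * v < u := mul_lt_of_lt_one_right hu0 hv1
  have huv2 : 0 < 1 - u * v := by linarith
  have hsum : 0 < 1 - u + u * v := by linarith
  have e1 := norm_ein_I_mul_sub_le (a := t * (1 - u * v)) (b := t) (mul_pos ht huv2)
    (mul_le_of_le_one_right ht.le (by linarith))
  have e2 := norm_ein_I_mul_sub_le (a := t * (1 - u)) (b := t * (1 - u + u * v)) (mul_pos ht hu)
    (by gcongr; linarith)
  have hlog : Real.log (1 + u * v / (1 - u)) ≤ 2 * √(u * v / (1 - u)) :=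
    log_one_add_le_two_mul_sqrt (by positivity)
  have d1 : t / (t * (1 - u * v)) ≤ 1 + u * v / (1 - u) := by
    rw [div_mul_cancel_left₀ ht.ne', inv_le_iff_one_le_mul₀ huv2, ← sub_nonneg]
    have : (1 + u * v / (1 - u)) * (1 - u * v) - 1 = u * v * (u - u * v) / (1 - u) := by
      field_simp
      ring
    rw [this]
    exact div_nonneg (mul_nonneg huv.le (by linarith)) hu.le
  have d2 : t * (1 - u + u * v) / (t * (1 - u)) = 1 + u * v / (1 - u) := by
    rw [mul_div_mul_left _ _ ht.ne', add_div, div_self hu.ne']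
  have l1 := (Real.log_le_log (by positivity) d1).trans hlog
  rw [d2] at e2
  have him : |(ein (Complex.I * t) + ein (Complex.I * (t * (1 - u) : ℝ))
      - ein (Complex.I * (t * (1 - u * v) : ℝ))
      - ein (Complex.I * (t * (1 - u + u * v) : ℝ))).im| ≤ 8 * √(u * v / (1 - u)) := by
    refine (Complex.abs_im_le_norm _).trans ?_
    have := norm_sub_le (ein (Complex.I * t) - ein (Complex.I * (t * (1 - u * v) : ℝ)))
      (ein (Complex.I * (t * (1 - u + u * v) : ℝ)) - ein (Complex.I * (t * (1 - u) : ℝ)))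
    rw [show ein (Complex.I * t) + ein (Complex.I * (t * (1 - u) : ℝ))
      - ein (Complex.I * (t * (1 - u * v) : ℝ)) - ein (Complex.I * (t * (1 - u + u * v) : ℝ))
      = (ein (Complex.I * t) - ein (Complex.I * (t * (1 - u * v) : ℝ)))
      - (ein (Complex.I * (t * (1 - u + u * v) : ℝ)) - ein (Complex.I * (t * (1 - u) : ℝ))) by ring]
    linarith
  have hsu : 0 < √u := Real.sqrt_pos.2 hu0
  have hsv : 0 < √v := Real.sqrt_pos.2 hv0
  have hsu1 : 0 < √(1 - u) := Real.sqrt_pos.2 hu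
  have hsv1 : 0 < √(1 - v) := Real.sqrt_pos.2 (by linarith)
  have hsv2 : √(1 - v) ≤ 1 := Real.sqrt_le_one.2 (by linarith)
  rw [unitKernel, abs_div, abs_of_pos huv, div_le_iff₀ huv]
  refine him.trans ?_
  rw [Real.sqrt_div huv.le, Real.sqrt_mul hu0.le]
  have hrw : 8 * (1 / (√u * √(1 - u))) * (1 / (√v * √(1 - v))) * (u * v)
      = 8 * (√u * √v / √(1 - u)) * (1 / √(1 - v)) := by
    have hprod : u * v = √u * √u * (√v * √v) := by
      rw [Real.mul_self_sqrt hu0.le, Real.mul_self_sqrt hv0.le]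
    rw [hprod]
    field_simp
  rw [hrw]
  exact le_mul_of_one_le_right (by positivity) ((one_le_div hsv1).2 hsv2)

theorem measurable_unitKernel (t : ℝ) : Measurable fun p : ℝ × ℝ => unitKernel t p.1 p.2 := by
  unfold unitKernel
  fun_prop

/-- With two plus and two minus signs, Ein(it) can be subtracted from each term; the remaining
differences tend to real logarithms. -/
theorem tendsto_unitKernel {u v : ℝ} (hu0 : 0 < u) (hu1 : u < 1) (hv0 : 0 < v) (hv1 : v < 1) :
    Tendsto (fun t => unitKernel t u v) atTop (𝓝 0) := by
  have huv : 0 < u * v := mul_pos hu0 hv0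
  have huv1 : u * v < u := mul_lt_of_lt_one_right hu0 hv1
  have h := ((tendsto_ein_I_mul_mul_sub (b := 1 - u) (by linarith)).sub
    (tendsto_ein_I_mul_mul_sub (b := 1 - u * v) (by linarith))).sub
    (tendsto_ein_I_mul_mul_sub (b := 1 - u + u * v) (by linarith))
  have h2 := ((Complex.continuous_im.tendsto _).comp h).div_const (u * v)
  simp only [Complex.sub_im, Complex.ofReal_im, sub_zero, zero_div] at h2
  refine h2.congr fun t => ?_
  simp only [Function.comp, unitKernel, Complex.sub_im, Complex.add_im]
  congr 1
  ring

theorem tendsto_tripleSine : Tendsto tripleSine atTop (𝓝 0) := by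
  have hw := intervalIntegrable_inv_sqrt_mul_sqrt
  have hbound : ∀ᶠ t : ℝ in atTop, ∀ u ∈ Ι (0 : ℝ) 1, u ≠ 1 → ∀ᵐ v : ℝ, v ∈ Ι (0 : ℝ) 1 →
      ‖unitKernel t u v‖ ≤ 8 * (1 / (√u * √(1 - u))) * (1 / (√v * √(1 - v))) := by
    filter_upwards [eventually_gt_atTop 0] with t ht u hu hu1
    filter_upwards [ae_ne_one] with v hne hv
    rw [uIoc_of_le zero_le_one] at hu hv
    exact abs_unitKernel_le ht hu.1 (lt_of_le_of_ne hu.2 hu1) hv.1 (lt_of_le_of_ne hv.2 hne)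
  have hinner : ∀ u ∈ Ι (0 : ℝ) 1, u ≠ 1 →
      Tendsto (fun t => ∫ v in (0 : ℝ)..1, unitKernel t u v) atTop (𝓝 0) := by
    intro u hu hu1
    have h := intervalIntegral.tendsto_integral_filter_of_dominated_convergence (a := 0) (b := 1)
      (μ := volume) (l := atTop) (F := fun t v => unitKernel t u v) (f := fun _ => (0 : ℝ))
      (fun v => 8 * (1 / (√u * √(1 - u))) * (1 / (√v * √(1 - v)))) ?_ ?_ (hw.const_mul _) ?_
    · simpa using h
    · exact Eventually.of_forall fun t => ((measurable_unitKernel t).comp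
        (f := fun v => (u, v)) (by fun_prop)).aestronglyMeasurable
    · exact hbound.mono fun t ht => ht u hu hu1
    · filter_upwards [ae_ne_one] with v hne hv
      rw [uIoc_of_le zero_le_one] at hu hv
      exact tendsto_unitKernel hu.1 (lt_of_le_of_ne hu.2 hu1) hv.1 (lt_of_le_of_ne hv.2 hne)
  have h := intervalIntegral.tendsto_integral_filter_of_dominated_convergence (a := 0) (b := 1)
    (μ := volume) (l := atTop) (F := fun t u => ∫ v in (0 : ℝ)..1, unitKernel t u v)
    (f := fun _ => (0 : ℝ)) (fun u => 8 * (1 / (√u * √(1 - u)))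
      * ∫ v in (0 : ℝ)..1, 1 / (√v * √(1 - v))) ?_ ?_ ((hw.const_mul _).mul_const _) ?_
  · rw [intervalIntegral.integral_zero] at h
    refine h.congr' ?_
    filter_upwards [eventually_ge_atTop 0] with t ht
    rw [tripleSine_eq_integral_unitKernel ht]
  · exact Eventually.of_forall fun t =>
      (measurable_intervalIntegral_right (measurable_unitKernel t) 0 1).aestronglyMeasurable
  · filter_upwards [hbound] with t ht
    filter_upwards [ae_ne_one] with u hne hu
    rw [← intervalIntegral.integral_const_mul]
    refine intervalIntegral.norm_integral_le_of_norm_le zero_le_one ?_ (hw.const_mul _)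
    filter_upwards [ht u hu hne] with v hv hmem
    exact hv (by rwa [uIoc_of_le zero_le_one])
  · filter_upwards [ae_ne_one] with u hne hu
    exact hinner u hu hne

end Vanishing

/-! ### Integration by parts and the remainder -/

section Asymptotics

theorem one_isBigO_log : (fun _ : ℝ => (1 : ℝ)) =O[atTop] fun x : ℝ => Real.log x :=
  Real.isLittleO_const_log_atTop.isBigO

theorem log_isBigO_log_sq :
    (fun x : ℝ => Real.log x) =O[atTop] fun x : ℝ => Real.log x ^ 2 :=
  ((isBigO_refl (fun x : ℝ => Real.log x) atTop).mul one_isBigO_log).congr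
    (fun _ => mul_one _) fun _ => (sq _).symm

theorem one_div_ofReal_pow_isBigO (n : ℕ) :
    (fun x : ℝ => 1 / (x : ℂ) ^ n) =O[atTop] fun x : ℝ => 1 / x ^ n :=
  IsBigO.of_bound 1 (Eventually.of_forall fun x => by simp)

theorem exp_I_mul_isBigO_one :
    (fun x : ℝ => Complex.exp (Complex.I * x)) =O[atTop] fun _ : ℝ => (1 : ℝ) :=
  IsBigO.of_bound 1 (Eventually.of_forall fun x => by simp)

theorem ein_neg_I_mul_isBigO_log :
    (fun x : ℝ => ein (Complex.I * (-1 * x : ℝ))) =O[atTop] fun x : ℝ => Real.log x :=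
  (ein_I_mul_isBigO_log.norm_left.congr_left fun x =>
    (norm_ein_I_mul_mul (s := -1) (by simp) x).symm).of_norm_left

theorem innerDouble_isBigO_log_sq : innerDouble =O[atTop] fun x : ℝ => Real.log x ^ 2 := by
  have h1 : (fun x : ℝ => ein (Complex.I * x) ^ 2 / 2) =O[atTop] fun x : ℝ => Real.log x ^ 2 :=
    ((ein_I_mul_isBigO_log.pow 2).const_mul_left (1 / 2)).congr_left fun x => by ring
  have h0 := one_isBigO_log.trans log_isBigO_log_sq
  exact (h1.add ((tendsto_oscInt_one.isBigO_one ℝ).trans h0)).add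
    ((tendsto_oscInt_neg_one.isBigO_one ℝ).trans h0)

/-- The square is handled by a² - b² = (a - b)(a + b), of size (1/x) · log x; the constant is π²/12
- π²/6. -/
theorem innerDouble_sub_isBigO :
    (fun x : ℝ => innerDouble x - ((Real.log x + (Real.eulerMascheroniConstant
      + Complex.I * (Real.pi / 2))) ^ 2 / 2 - Real.pi ^ 2 / 12)) =O[atTop]
      fun x : ℝ => Real.log x / x := by
  set κ : ℂ := Real.eulerMascheroniConstant + Complex.I * (Real.pi / 2) with hκ
  have h1 := oscInt_sub_isBigO (by simp) tendsto_oscInt_one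
  have h2 := oscInt_sub_isBigO (by simp) tendsto_oscInt_neg_one
  have hlog : (fun x : ℝ => (Real.log x : ℂ) + κ) =O[atTop] fun x : ℝ => Real.log x :=
    (IsBigO.of_bound 1 (Eventually.of_forall fun x => by simp)).add
      ((isBigO_const_const κ one_ne_zero atTop).trans one_isBigO_log)
  have h3 := (ein_I_mul_sub_log_isBigO.mul (ein_I_mul_isBigO_log.add hlog)).const_mul_left (1 / 2)
  have h4 : (fun x : ℝ => 1 / x * Real.log x) = fun x : ℝ => Real.log x / x := by
    ext x; ring
  rw [h4] at h3
  refine ((h3.add h1).add h2).congr_left fun x => ?_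
  rw [innerDouble, ← hκ]
  ring

theorem ein_neg_I_mul_sub_log_isBigO :
    (fun x : ℝ => ein (Complex.I * (-1 * x : ℝ)) - (Real.log x
      + (Real.eulerMascheroniConstant - Complex.I * (Real.pi / 2)))) =O[atTop]
      fun x : ℝ => 1 / x := by
  refine (ein_I_mul_sub_log_isBigO.norm_left.congr_left fun x => ?_).of_norm_left
  rw [← Complex.norm_conj]
  congr 1
  simp only [map_sub, map_add, map_mul, map_div₀, map_ofNat, conj_ein, Complex.conj_ofReal, Complex.conj_I]
  simp
  ring

/-- The oscillating part of the expansion of `tripleSine` up to second order. -/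
noncomputable def oscillatingPart (t : ℝ) : ℂ :=
  -Complex.I * Complex.exp (Complex.I * t) * innerDouble t / t
    + Complex.exp (Complex.I * t) * (ein (Complex.I * t) - innerDouble t) / t ^ 2

/-- The derivative of the remainder of `oscillatingPart`. -/
noncomputable def oscillatingDefect (t : ℝ) : ℂ :=
  Complex.exp (Complex.I * t) * ((1 - Complex.exp (-(Complex.I * t)))
    - (ein (Complex.I * t) + Complex.exp (-(Complex.I * t)) * ein (Complex.I * (-1 * t : ℝ)))
    - 2 * (ein (Complex.I * t) - innerDouble t)) * (1 / (t : ℂ) ^ 3)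

/-- The second summand of `oscillatingPart` cancels the oscillating t⁻² terms left by the first. The
term with Ein(-it) survives because e^{it} meets e^{-it} in G'. -/
theorem hasDerivAt_oscillatingPart {t : ℝ} (ht : t ≠ 0) :
    HasDerivAt oscillatingPart (Complex.exp (Complex.I * t) * innerDouble t / t
      - Complex.I * ein (Complex.I * (-1 * t : ℝ)) / t ^ 2 + oscillatingDefect t) t := by
  have ht' : (t : ℂ) ≠ 0 := Complex.ofReal_ne_zero.2 ht
  have h1 : HasDerivAt (fun y : ℝ => (y : ℂ)) 1 t := Complex.ofRealCLM.hasDerivAt (x := t)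
  have he := (h1.const_mul Complex.I).cexp
  have hG := hasDerivAt_innerDouble ht
  refine ((((he.const_mul (-Complex.I)).fun_mul hG).fun_div h1 ht').fun_add
    ((he.fun_mul ((hasDerivAt_ein_I_mul ht).fun_sub hG)).fun_div (h1.fun_pow 2)
      (pow_ne_zero 2 ht'))).congr_deriv ?_
  rw [oscillatingDefect, Complex.exp_neg]
  have := Complex.exp_ne_zero (Complex.I * t)
  field_simp
  push_cast
  ring_nf
  simp only [Complex.I_sq]
  ring

theorem oscillatingDefect_isBigO :
    oscillatingDefect =O[atTop] fun t : ℝ => Real.log t ^ 2 / t ^ 3 := by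
  have h0 := one_isBigO_log.trans log_isBigO_log_sq
  have hexp : (fun x : ℝ => Complex.exp (-(Complex.I * x))) =O[atTop] fun _ : ℝ => (1 : ℝ) :=
    IsBigO.of_bound 1 (Eventually.of_forall fun x => by simp [norm_exp_neg_I_mul])
  have hA := ein_I_mul_isBigO_log.trans log_isBigO_log_sq
  have h1 := (((isBigO_const_const (1 : ℂ) one_ne_zero atTop).sub hexp).trans h0).sub
    (hA.add ((hexp.mul (ein_neg_I_mul_isBigO_log.trans log_isBigO_log_sq)).congr_right
      fun _ => one_mul _))
  have h2 := h1.sub ((hA.sub innerDouble_isBigO_log_sq).const_mul_left 2)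
  refine ((exp_I_mul_isBigO_one.mul h2).mul (one_div_ofReal_pow_isBigO 3)).congr_right fun t => ?_
  ring

theorem oscillatingPart_correction_isBigO :
    (fun t : ℝ => Complex.exp (Complex.I * t) * (ein (Complex.I * t) - innerDouble t) / t ^ 2)
      =O[atTop] fun t : ℝ => Real.log t ^ 2 / t ^ 2 := by
  refine ((exp_I_mul_isBigO_one.mul ((ein_I_mul_isBigO_log.trans log_isBigO_log_sq).sub
    innerDouble_isBigO_log_sq)).mul (one_div_ofReal_pow_isBigO 2)).congr (fun t => ?_) fun t => ?_
  · ring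
  · ring

theorem tendsto_log_sq_div_sq : Tendsto (fun t : ℝ => Real.log t ^ 2 / t ^ 2) atTop (𝓝 0) := by
  simpa [div_pow] using (tendsto_log_pow_div_atTop 1).pow 2

theorem tendsto_oscillatingPart : Tendsto oscillatingPart atTop (𝓝 0) := by
  have h1 : (fun t : ℝ => -Complex.I * Complex.exp (Complex.I * t) * innerDouble t / t)
      =O[atTop] fun t : ℝ => Real.log t ^ 2 / t := by
    refine (((exp_I_mul_isBigO_one.mul innerDouble_isBigO_log_sq).mul
      (one_div_ofReal_pow_isBigO 1)).const_mul_left (-Complex.I)).congr (fun t => ?_) fun t => ?_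
    · ring
    · ring
  have h2 := (h1.trans_tendsto (tendsto_log_pow_div_atTop 2)).add
    (oscillatingPart_correction_isBigO.trans_tendsto tendsto_log_sq_div_sq)
  rwa [add_zero] at h2

theorem hasDerivAt_log_add_div {t : ℝ} (c : ℝ) (ht : t ≠ 0) :
    HasDerivAt (fun t : ℝ => -(Real.log t + 1 + c) / t) ((Real.log t + c) / t ^ 2) t := by
  refine ((((Real.hasDerivAt_log ht).add_const 1).add_const c).fun_neg.fun_div (hasDerivAt_id' t)
    ht).congr_deriv ?_
  field_simp
  ring

theorem isBigO_im {f : ℝ → ℂ} {g : ℝ → ℝ} (h : f =O[atTop] g) :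
    (fun t => (f t).im) =O[atTop] g :=
  (IsBigO.of_bound 1 (Eventually.of_forall fun t => by
    simpa using Complex.abs_im_le_norm (f t))).trans h

theorem tripleSine_sub_isBigO :
    (fun t : ℝ => tripleSine t - (oscillatingPart t).im
      - -(Real.log t + 1 + Real.eulerMascheroniConstant) / t) =O[atTop]
      fun t : ℝ => Real.log t ^ 2 / t ^ 2 := by
  set γ := Real.eulerMascheroniConstant with hγ
  have hO : (fun t : ℝ => (Complex.I * (ein (Complex.I * (-1 * t : ℝ)) - (Real.log t
      + (γ - Complex.I * (Real.pi / 2)))) * (1 / (t : ℂ) ^ 2) - oscillatingDefect t).im) =O[atTop]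
      fun t : ℝ => Real.log t ^ 2 / t ^ 3 := by
    refine isBigO_im (IsBigO.sub ?_ oscillatingDefect_isBigO)
    refine ((((ein_neg_I_mul_sub_log_isBigO.const_mul_left Complex.I).mul
      (one_div_ofReal_pow_isBigO 2)).congr_right fun t => ?_).trans
      ((one_isBigO_log.trans log_isBigO_log_sq).mul (isBigO_refl (fun t : ℝ => 1 / t ^ 3) atTop))
      ).congr_right fun t => ?_
    · ring
    · ring
  have hderiv : ∀ᶠ t : ℝ in atTop, HasDerivAt (fun t : ℝ => tripleSine t - (oscillatingPart t).im
      - -(Real.log t + 1 + γ) / t) (Complex.I * (ein (Complex.I * (-1 * t : ℝ)) - (Real.log t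
      + (γ - Complex.I * (Real.pi / 2)))) * (1 / (t : ℂ) ^ 2) - oscillatingDefect t).im t := by
    filter_upwards [eventually_gt_atTop 0] with t ht
    have him : HasDerivAt (fun t => (oscillatingPart t).im) _ t :=
      Complex.imCLM.hasFDerivAt.comp_hasDerivAt t (hasDerivAt_oscillatingPart ht.ne')
    refine (((hasDerivAt_tripleSine ht).fun_sub him).fun_sub
      (hasDerivAt_log_add_div γ ht.ne')).congr_deriv ?_
    -- Multiplied by i, the part -iπ/2 becomes real and drops out of the imaginary part.
    have hlog : (Real.log t + γ) / t ^ 2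
        = (Complex.I * (Real.log t + (γ - Complex.I * (Real.pi / 2))) * (1 / (t : ℂ) ^ 2)).im := by
      rw [show (1 / (t : ℂ) ^ 2) = ((1 / t ^ 2 : ℝ) : ℂ) by push_cast; rfl, Complex.im_mul_ofReal]
      have : (Real.pi / 2 : ℂ) = ((Real.pi / 2 : ℝ) : ℂ) := by push_cast; rfl
      rw [this]
      simp [-Complex.ofReal_div]
      ring
    rw [Complex.imCLM_apply, hlog, ← Complex.sub_im, ← Complex.sub_im]
    congr 1
    ring
  obtain ⟨c, hc⟩ := exists_isBigO_log_sq_div_of_deriv hderiv hO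
  have hlim1 : Tendsto (fun t : ℝ => tripleSine t - (oscillatingPart t).im
      - -(Real.log t + 1 + γ) / t) atTop (𝓝 (0 - 0 - 0)) := by
    refine (tendsto_tripleSine.sub ?_).sub ?_
    · exact (Complex.continuous_im.tendsto 0).comp tendsto_oscillatingPart
    · have h1 := tendsto_log_pow_div_atTop 1
      have h2 := (tendsto_inv_atTop_zero (𝕜 := ℝ)).const_mul (1 + γ)
      have h3 := (h1.add h2).neg
      rw [mul_zero, add_zero, neg_zero] at h3
      refine h3.congr fun t => ?_
      ring
  have hlim2 : Tendsto (fun t : ℝ => tripleSine t - (oscillatingPart t).im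
      - -(Real.log t + 1 + γ) / t) atTop (𝓝 c) := by
    simpa using (hc.trans_tendsto tendsto_log_sq_div_sq).add_const c
  -- All three functions vanish at infinity, so there is no constant of integration.
  have hc0 : c = 0 := by simpa using tendsto_nhds_unique hlim2 hlim1
  simpa [hc0] using hc

end Asymptotics

/-! ### Assembly of the expansion -/

theorem mainTheorem5 :
    (∀ t : ℝ, 0 < t →
      MeasureTheory.IntegrableOn (fun p : ℝ × ℝ × ℝ => tripleIntegrand p.1 p.2.1 p.2.2)
        {p : ℝ × ℝ × ℝ | 0 < p.2.2 ∧ p.2.2 < p.2.1 ∧ p.2.1 < p.1 ∧ p.1 < t}) ∧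
    Asymptotics.IsBigO Filter.atTop
      (fun t : ℝ => tripleSine t -
        (-(Real.cos t / 2) * (Real.log t ^ 2 / t)
          + (Real.pi * Real.sin t / 2 - Real.eulerMascheroniConstant * Real.cos t - 1)
              * (Real.log t / t)
          + (5 * Real.pi ^ 2 * Real.cos t / 24
              - Real.eulerMascheroniConstant ^ 2 * Real.cos t / 2
              + Real.eulerMascheroniConstant * Real.pi * Real.sin t / 2
              - 1 - Real.eulerMascheroniConstant) * (1 / t)))
      (fun t : ℝ => Real.log t ^ 2 / t ^ 2) := by
  refine ⟨fun t _ => integrableOn_tripleIntegrand t, ?_⟩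
  set γ := Real.eulerMascheroniConstant with hγ
  -- Replacing G by its main term in the leading part costs O(log t/t²), within the allowed error.
  have h1 : (fun t : ℝ => -Complex.I * Complex.exp (Complex.I * t) * (innerDouble t
      - ((Real.log t + (γ + Complex.I * (Real.pi / 2))) ^ 2 / 2 - Real.pi ^ 2 / 12)) / t)
      =O[atTop] fun t : ℝ => Real.log t ^ 2 / t ^ 2 := by
    refine ((((exp_I_mul_isBigO_one.mul innerDouble_sub_isBigO).mul
      (one_div_ofReal_pow_isBigO 1)).const_mul_left (-Complex.I)).congr (fun t => ?_)
      fun t => ?_).trans (log_isBigO_log_sq.mul (isBigO_refl (fun t : ℝ => 1 / t ^ 2) atTop))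
      |>.congr_right fun t => ?_
    · ring
    · ring
    · ring
  have h2 := (tripleSine_sub_isBigO.add (isBigO_im oscillatingPart_correction_isBigO)).add
    (isBigO_im h1)
  refine h2.congr_left fun t => ?_
  have hosc : (oscillatingPart t).im
      = (-Complex.I * Complex.exp (Complex.I * t) * innerDouble t / t).im
        + (Complex.exp (Complex.I * t) * (ein (Complex.I * t) - innerDouble t) / t ^ 2).im := by
    rw [oscillatingPart, Complex.add_im]
  -- Squaring log t + γ + iπ/2 gives -π²/8 after halving, and -π²/8 - π²/12 = -5π²/24.
  have hmain : (-Complex.I * Complex.exp (Complex.I * t)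
      * ((Real.log t + (γ + Complex.I * (Real.pi / 2))) ^ 2 / 2 - Real.pi ^ 2 / 12) / t).im
      = (-Real.cos t * ((Real.log t + γ) ^ 2 / 2 - 5 * Real.pi ^ 2 / 24)
        + Real.sin t * ((Real.log t + γ) * Real.pi / 2)) / t := by
    have hexp : -Complex.I * Complex.exp (Complex.I * t)
        * ((Real.log t + (γ + Complex.I * (Real.pi / 2))) ^ 2 / 2 - Real.pi ^ 2 / 12)
        = ((Real.sin t * ((Real.log t + γ) ^ 2 / 2 - 5 * Real.pi ^ 2 / 24)
            + Real.cos t * ((Real.log t + γ) * Real.pi / 2) : ℝ) : ℂ)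
          + ((-Real.cos t * ((Real.log t + γ) ^ 2 / 2 - 5 * Real.pi ^ 2 / 24)
            + Real.sin t * ((Real.log t + γ) * Real.pi / 2) : ℝ) : ℂ) * Complex.I := by
      rw [mul_comm Complex.I (t : ℂ), Complex.exp_mul_I, ← Complex.ofReal_cos,
        ← Complex.ofReal_sin]
      push_cast
      generalize Complex.cos t = c
      generalize Complex.sin t = s
      generalize Complex.log t = l
      ring_nf
      simp only [Complex.I_sq, Complex.I_pow_three, Complex.I_pow_four]
      ring
    rw [hexp, Complex.div_ofReal_im]
    simp [-Complex.ofReal_add, -Complex.ofReal_mul]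
  have hsplit : (-Complex.I * Complex.exp (Complex.I * t) * (innerDouble t
      - ((Real.log t + (γ + Complex.I * (Real.pi / 2))) ^ 2 / 2 - Real.pi ^ 2 / 12)) / t).im
      = (-Complex.I * Complex.exp (Complex.I * t) * innerDouble t / t).im
      - (-Complex.I * Complex.exp (Complex.I * t)
      * ((Real.log t + (γ + Complex.I * (Real.pi / 2))) ^ 2 / 2 - Real.pi ^ 2 / 12) / t).im := by
    rw [← Complex.sub_im]
    congr 1
    ring
  rw [hosc, hsplit, hmain]
  ring
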